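/- **Conventions.** Let $U\subseteq\mathbb R^n$ be open, with the coordinates $x^i$ of $\mathbb R^n$; metrics, 1-forms and functions are smooth. A Finsler metric $F$ on $U$ is *dually flat on $U$* if $\sum_k [F^2]_{x^ky^l}y^k-2[F^2]_{x^l}=0$ for all $l$, $x\in U$, $y\neq0$. For a Riemannian metric $\bar\alpha=\sqrt{\bar a_{ij}(x)y^iy^j}$ let $G^i_{\bar\alpha}=\frac12\bar\Gamma^i_{jk}y^jy^k$ be its spray coefficients. A 1-form $\bar\beta=\bar b_i(x)y^i$ is *dually related* to $\bar\alpha$ if there are a 1-form $\theta=\theta_i(x)y^i$ and a scalar function $c(x)$ on $U$ with $$G^i_{\bar\alpha}=2\theta y^i+\bar\alpha^2\theta^i,\qquad \bar b_{i|j}=2\theta_i\bar b_j+c\,\bar a_{ij},$$ where $\theta^i=\bar a^{ij}\theta_j$ and $\bar b_{i|j}=\partial_{x^j}\bar b_i-\bar\Gamma^k_{ij}\bar b_k$ is the covariant derivative with respect to $\bar\alpha$. **Theorem 1.2.** Let $n\ge3$, let $U\subseteq\mathbb R^n$ be open, and let $k_1,k_2,k_3\in\mathbb R$, $\Delta_1:=k_2^2+4k_3$.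 Let $\phi$ be a positive smooth function on a symmetric open interval $(-b_o,b_o)$, $0<b_o\le\infty$, with $\phi'(0)\ne0$ and $$s(k_2-k_3s^2)(\phi\phi'-s\phi'^2-s\phi\phi'')-(\phi'^2+\phi\phi'')+k_1\phi(\phi-s\phi')=0 .$$ Let $\alpha=\sqrt{a_{ij}(x)y^iy^j}$ be a Riemannian metric and $\beta=b_i(x)y^i$ a 1-form on $U$ with $\beta/\alpha\in(-b_o,b_o)$ for all $y\ne0$, such that $F=\alpha\phi(\beta/\alpha)$ is a Finsler metric on $U$ that is not Riemannian on any connected component of $U$. Let $b:=\|\beta\|_\alpha$ and suppose that $1+k_2b^2-k_3b^4>0$ on $U$ and, if $k_3\neq0$ and $\Delta_1=0$, also $2+k_2b^2>0$ on $U$. Then $F$ is dually flat on $U$ if and only if there are a dually flat Riemannian metric $\bar\alpha$ on $U$ and a 1-form $\bar\beta$ on $U$ dually related to $\bar\alpha$ such that, with $\bar b:=\|\bar\beta\|_{\bar\alpha}$, one has $1+k_2\bar b^2-k_3\bar b^4>0$ (and $2+k_2\bar b^2>0$ if $k_3\ne0$, $\Delta_1=0$) and $$\alpha=\eta(\bar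 b^2)\sqrt{\bar\alpha^2-\frac{k_2-k_3\bar b^2}{1+k_2\bar b^2-k_3\bar b^4}\,\bar\beta^2},\qquad \beta=-\frac{\eta(\bar b^2)}{(1+k_2\bar b^2-k_3\bar b^4)^{1/2}}\,\bar\beta .$$ Here $\eta$ is given as follows. 1. If $k_3=0$, $k_2=0$: $\ \eta(\bar b^2)=\exp\{k_1\bar b^2/4\}$. 2. If $k_3=0$, $k_2\ne0$: $\ \eta(\bar b^2)=(1+k_2\bar b^2)^{\frac{k_1-k_2}{4k_2}}$. 3. If $k_3\ne0$, $\Delta_1>0$: $$\eta(\bar b^2)=\frac{\left\{\dfrac{\sqrt{\Delta_1}+k_2}{\sqrt{\Delta_1}-k_2}\cdot\dfrac{\sqrt{\Delta_1}-k_2+2k_3\bar b^2}{\sqrt{\Delta_1}+k_2-2k_3\bar b^2}\right\}^{\frac{2k_1-k_2}{8\sqrt{\Delta_1}}}}{\sqrt[8]{1+k_2\bar b^2-k_3\bar b^4}} .$$ 4. If $k_3\ne0$, $\Delta_1=0$: $$\eta(\bar b^2)=\frac{\sqrt[4]{2}\,\exp\left\{\frac{k_2-2k_1}{2k_2}\left[\frac1{2+k_2\bar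 b^2}-\frac12\right]\right\}}{\sqrt[4]{2+k_2\bar b^2}} .$$ 5. If $k_3\ne0$, $\Delta_1<0$: $$\eta(\bar b^2)=\frac{\exp\left\{\frac{2k_1-k_2}{4\sqrt{-\Delta_1}}\left(\arctan\frac{k_2-2k_3\bar b^2}{\sqrt{-\Delta_1}}-\arctan\frac{k_2}{\sqrt{-\Delta_1}}\right)\right\}}{\sqrt[8]{1+k_2\bar b^2-k_3\bar b^4}} .$$ -/

import Mathlib

open scoped ContDiff Matrix

noncomputable section

namespace AlphaBeta

variable {n : ℕ}

/-- The partial derivative `∂f/∂xⁱ` at the point `x` of `ℝⁿ`. -/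
def pd (i : Fin n) (f : (Fin n → ℝ) → ℝ) (x : Fin n → ℝ) : ℝ :=
  fderiv ℝ f x (Pi.single i 1)

/-- `a = (a_ij)` is a smooth Riemannian metric on the open set `U ⊆ ℝⁿ`
(`Matrix.PosDef` contains the symmetry of the matrix). -/
structure IsRiemannianMetricOn (U : Set (Fin n → ℝ))
    (a : (Fin n → ℝ) → Matrix (Fin n) (Fin n) ℝ) : Prop where
  smooth : ∀ i j, ContDiffOn ℝ ∞ (fun x => a x i j) U
  posDef : ∀ x ∈ U, (a x).PosDef

/-- `b = (b_i)` is a smooth 1-form on the open set `U ⊆ ℝⁿ`. -/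
def IsOneFormOn (U : Set (Fin n → ℝ)) (b : (Fin n → ℝ) → Fin n → ℝ) : Prop :=
  ∀ i, ContDiffOn ℝ ∞ (fun x => b x i) U

/-- The length function `α(x, y) = √(a_ij(x) yⁱ yʲ)` of a Riemannian metric. -/
def alpha (a : (Fin n → ℝ) → Matrix (Fin n) (Fin n) ℝ) (x y : Fin n → ℝ) : ℝ :=
  Real.sqrt (y ⬝ᵥ (a x *ᵥ y))

/-- The value `β(x, y) = b_i(x) yⁱ` of a 1-form. -/
def beta (b : (Fin n → ℝ) → Fin n → ℝ) (x y : Fin n → ℝ) : ℝ :=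
  b x ⬝ᵥ y

/-- Raising the index of a covector: `a^{ij}(x) ξ_j`. -/
def raise (a : (Fin n → ℝ) → Matrix (Fin n) (Fin n) ℝ) (x : Fin n → ℝ) (ξ : Fin n → ℝ) :
    Fin n → ℝ :=
  (a x)⁻¹ *ᵥ ξ

/-- The squared norm `‖β‖²_α = a^{ij} b_i b_j` at `x`. -/
def normSq (a : (Fin n → ℝ) → Matrix (Fin n) (Fin n) ℝ) (b : (Fin n → ℝ) → Fin n → ℝ)
    (x : Fin n → ℝ) : ℝ :=
  b x ⬝ᵥ raise a x (b x)

/-- The function `F = α φ(β / α)`; it vanishes at `y = 0`. -/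
def alphaBetaFun (φ : ℝ → ℝ) (a : (Fin n → ℝ) → Matrix (Fin n) (Fin n) ℝ)
    (b : (Fin n → ℝ) → Fin n → ℝ) (x y : Fin n → ℝ) : ℝ :=
  alpha a x y * φ (beta b x y / alpha a x y)

/-- The fundamental tensor `g_ij(x, y) = [F²/2]_{yⁱ yʲ}`. -/
def fundamentalTensor (F : (Fin n → ℝ) → (Fin n → ℝ) → ℝ) (x y : Fin n → ℝ) :
    Matrix (Fin n) (Fin n) ℝ :=
  Matrix.of fun i j => pd i (fun y' => pd j (fun y'' => F x y'' ^ 2 / 2) y') y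

/-- `F` is a Finsler metric on the open set `U ⊆ ℝⁿ` (with `TU = U × ℝⁿ`). -/
structure IsFinslerMetricOn (U : Set (Fin n → ℝ)) (F : (Fin n → ℝ) → (Fin n → ℝ) → ℝ) :
    Prop where
  nonneg : ∀ x ∈ U, ∀ y, 0 ≤ F x y
  continuous : ContinuousOn (fun p : (Fin n → ℝ) × (Fin n → ℝ) => F p.1 p.2) (U ×ˢ Set.univ)
  smooth : ContDiffOn ℝ ∞ (fun p : (Fin n → ℝ) × (Fin n → ℝ) => F p.1 p.2) (U ×ˢ {0}ᶜ)
  homogeneous : ∀ x ∈ U, ∀ y, ∀ r : ℝ, 0 < r → F x (r • y) = r * F x y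
  strongly_convex : ∀ x ∈ U, ∀ y, y ≠ 0 → (fundamentalTensor F x y).PosDef

/-- `F` is (the length function of) a Riemannian metric on the open set `V`. -/
def IsRiemannianOn (V : Set (Fin n → ℝ)) (F : (Fin n → ℝ) → (Fin n → ℝ) → ℝ) : Prop :=
  ∃ g, IsRiemannianMetricOn V g ∧ ∀ x ∈ V, ∀ y, F x y = alpha g x y

/-- `F` is dually flat on `U ⊆ ℝⁿ`, the coordinates of `ℝⁿ` being adapted:
`[F²]_{xᵏ yˡ} yᵏ - 2 [F²]_{xˡ} = 0` on the slit tangent bundle. -/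
def IsDuallyFlatOn (U : Set (Fin n → ℝ)) (F : (Fin n → ℝ) → (Fin n → ℝ) → ℝ) : Prop :=
  ∀ x ∈ U, ∀ y, y ≠ 0 → ∀ l,
    ∑ k, pd l (fun y' => pd k (fun x' => F x' y' ^ 2) x) y * y k
      - 2 * pd l (fun x' => F x' y ^ 2) x = 0

/-- The Christoffel symbols `Γⁱ_jk` of a Riemannian metric. -/
def christoffel (a : (Fin n → ℝ) → Matrix (Fin n) (Fin n) ℝ) (x : Fin n → ℝ)
    (i j k : Fin n) : ℝ :=
  1 / 2 * ∑ m, (a x)⁻¹ i m *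
    (pd j (fun x' => a x' m k) x + pd k (fun x' => a x' m j) x - pd m (fun x' => a x' j k) x)

/-- The spray coefficients `Gⁱ = Γⁱ_jk yʲ yᵏ / 2` of a Riemannian metric. -/
def spray (a : (Fin n → ℝ) → Matrix (Fin n) (Fin n) ℝ) (x y : Fin n → ℝ) (i : Fin n) : ℝ :=
  1 / 2 * ∑ j, ∑ k, christoffel a x i j k * y j * y k

/-- The covariant derivative `b_{i|j} = ∂b_i/∂xʲ - Γᵏ_ij b_k` of a 1-form. -/
def covDeriv (a : (Fin n → ℝ) → Matrix (Fin n) (Fin n) ℝ) (b : (Fin n → ℝ) → Fin n → ℝ)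
    (x : Fin n → ℝ) (i j : Fin n) : ℝ :=
  pd j (fun x' => b x' i) x - ∑ k, christoffel a x k i j * b x k

/-- The 1-form `β = b_i yⁱ` is dually related to the Riemannian metric `α`: for a 1-form `θ` and
a scalar function `c` one has `Gⁱ_α = 2 θ yⁱ + α² θⁱ` and `b_{i|j} = 2 θ_i b_j + c a_ij`. -/
def IsDuallyRelatedOn (U : Set (Fin n → ℝ)) (a : (Fin n → ℝ) → Matrix (Fin n) (Fin n) ℝ)
    (b : (Fin n → ℝ) → Fin n → ℝ) : Prop :=
  ∃ (θ : (Fin n → ℝ) → Fin n → ℝ) (c : (Fin n → ℝ) → ℝ),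
    IsOneFormOn U θ ∧ ContDiffOn ℝ ∞ c U ∧
    (∀ x ∈ U, ∀ y i,
      spray a x y i = 2 * beta θ x y * y i + alpha a x y ^ 2 * raise a x (θ x) i) ∧
    (∀ x ∈ U, ∀ i j, covDeriv a b x i j = 2 * θ x i * b x j + c x * a x i j)

/-- `I` is an open interval `(-b₀, b₀)` with `0 < b₀ ≤ ∞`. -/
structure IsSymmetricOpenInterval (I : Set ℝ) : Prop where
  isOpen : IsOpen I
  ordConnected : I.OrdConnected
  zero_mem : (0 : ℝ) ∈ I
  neg_mem : ∀ s ∈ I, -s ∈ I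

/-- The three-parameter equation
`s(k₂ - k₃s²)(φφ' - sφ'² - sφφ'') - (φ'² + φφ'') + k₁φ(φ - sφ') = 0` at every `s ∈ I`. -/
def SolvesODE (k₁ k₂ k₃ : ℝ) (I : Set ℝ) (φ : ℝ → ℝ) : Prop :=
  ∀ s ∈ I,
    s * (k₂ - k₃ * s ^ 2) *
        (φ s * deriv φ s - s * deriv φ s ^ 2 - s * φ s * deriv (deriv φ) s)
      - (deriv φ s ^ 2 + φ s * deriv (deriv φ) s)
      + k₁ * φ s * (φ s - s * deriv φ s) = 0

/-- `1 + k₂ t - k₃ t²`, to be evaluated at the squared norm `t`. -/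
def deformQ (k₂ k₃ t : ℝ) : ℝ := 1 + k₂ * t - k₃ * t ^ 2

/-- The quantities whose real powers enter the deformation at the squared norm `t` are positive
(`2 + k₂ t` enters only if `k₃ ≠ 0` and `k₂² + 4k₃ = 0`). -/
def Admissible (k₂ k₃ t : ℝ) : Prop :=
  0 < deformQ k₂ k₃ t ∧ (k₃ ≠ 0 → k₂ ^ 2 + 4 * k₃ = 0 → 0 < 2 + k₂ * t)

open Classical in
/-- The deformation factor `η(t)`, `t` being the squared norm. -/
def eta (k₁ k₂ k₃ t : ℝ) : ℝ :=
  let Δ := k₂ ^ 2 + 4 * k₃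
  let r := Real.sqrt Δ
  let p := Real.sqrt (-Δ)
  if k₃ = 0 then
    if k₂ = 0 then Real.exp (k₁ * t / 4)
    else (1 + k₂ * t) ^ ((k₁ - k₂) / (4 * k₂))
  else if 0 < Δ then
    ((r + k₂) / (r - k₂) * ((r - k₂ + 2 * k₃ * t) / (r + k₂ - 2 * k₃ * t)))
        ^ ((2 * k₁ - k₂) / (8 * r))
      / (deformQ k₂ k₃ t) ^ (1 / 8 : ℝ)
  else if Δ = 0 then
    (2 : ℝ) ^ (1 / 4 : ℝ) * Real.exp ((k₂ - 2 * k₁) / (2 * k₂) * (1 / (2 + k₂ * t) - 1 / 2))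
      / (2 + k₂ * t) ^ (1 / 4 : ℝ)
  else
    Real.exp ((2 * k₁ - k₂) / (4 * p) *
        (Real.arctan ((k₂ - 2 * k₃ * t) / p) - Real.arctan (k₂ / p)))
      / (deformQ k₂ k₃ t) ^ (1 / 8 : ℝ)

/-- `α` and `β` are expressed on `U` through `ᾱ` and `β̄` by
`α = η √(ᾱ² - (k₂ - k₃ b̄²) / (1 + k₂ b̄² - k₃ b̄⁴) β̄²)` and
`β = - η / √(1 + k₂ b̄² - k₃ b̄⁴) β̄`, with `η = η(b̄²)`, where these expressions make sense. -/
def IsDeformationOn (k₁ k₂ k₃ : ℝ) (U : Set (Fin n → ℝ))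
    (a : (Fin n → ℝ) → Matrix (Fin n) (Fin n) ℝ) (b : (Fin n → ℝ) → Fin n → ℝ)
    (a' : (Fin n → ℝ) → Matrix (Fin n) (Fin n) ℝ) (b' : (Fin n → ℝ) → Fin n → ℝ) : Prop :=
  ∀ x ∈ U, Admissible k₂ k₃ (normSq a' b' x) ∧ ∀ y,
    alpha a x y = eta k₁ k₂ k₃ (normSq a' b' x) *
      Real.sqrt (alpha a' x y ^ 2
        - (k₂ - k₃ * normSq a' b' x) / deformQ k₂ k₃ (normSq a' b' x) * beta b' x y ^ 2) ∧
    beta b x y = -(eta k₁ k₂ k₃ (normSq a' b' x)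
        / (deformQ k₂ k₃ (normSq a' b' x)) ^ (1 / 2 : ℝ)) * beta b' x y

end AlphaBeta

end

/-
At a point where `β ≠ 0` the equation of dual flatness is, in the direction `v`, a combination of a
polynomial in `y` that is even and one that is odd, with coefficients depending on `β / α`. Near a
null vector of `β` the coefficients are independent enough to separate the two by parity, so both
vanish identically, and this forces the first jets of `α` and `β` to be built from a covector `θ`
and a number `m`. In these terms the dual relation between `ᾱ` and `β̄` has the same shape, and the
deformation carries one set of jets into the other because the logarithmic derivative of `η` is
`(k₁ - k₂ + k₃ t) / (4 (1 + k₂ t - k₃ t²))`; the squared norm `t` is preserved.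

For the dual pair, `θ` and the scalar are traces of the jets of `ᾱ` and `β̄`, so they are smooth and
the dual relation persists on the closure of `{β̄ ≠ 0}`. If this closure misses a point, then near
it `β̄` and the scalar are zero; both satisfy a linear first order system on all of `U`, so that
`β̄` vanishes on the connected component and `α φ(β/α)` is Riemannian there.
-/

open LinearMap (BilinForm)
open scoped Topology

noncomputable section

namespace AlphaBeta

section FlatJets

variable {V : Type*} [AddCommGroup V] [Module ℝ V]

lemma eq_zero_of_eventually_eq_zero_along_lines {P : V → ℝ} (u₀ : V)
    (hP : ∀ z, AnalyticOnNhd ℝ (fun r : ℝ => P (u₀ + r • z)) Set.univ)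
    (h : ∀ z, ∀ᶠ r in 𝓝 (0 : ℝ), P (u₀ + r • z) = 0) (y : V) : P y = 0 := by
  have := (hP (y - u₀)).eqOn_zero_of_preconnected_of_eventuallyEq_zero isPreconnected_univ
    (Set.mem_univ 0) (h (y - u₀)) (Set.mem_univ 1)
  simpa using this

lemma eventually_mul_neg_add_neg_mul_ne_zero {f g : ℝ → ℝ} (hf : ContinuousAt f 0)
    (hg : ContinuousAt g 0) (hf0 : f 0 ≠ 0) (hg0 : g 0 ≠ 0) :
    ∀ᶠ s in 𝓝 0, f s * g (-s) + f (-s) * g s ≠ 0 := by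
  have comp_neg : ∀ {h : ℝ → ℝ}, ContinuousAt h 0 → ContinuousAt (fun s => h (-s)) 0 :=
    fun hh => ContinuousAt.comp (by simpa using hh) continuousAt_neg
  refine ((hf.mul (comp_neg hg)).add ((comp_neg hf).mul hg)).eventually_ne ?_
  have : 2 * (f 0 * g 0) ≠ 0 := by positivity
  simpa only [Pi.add_apply, Pi.mul_apply, neg_zero, two_mul] using this

section

variable {G : BilinForm ℝ V} {β : V →ₗ[ℝ] ℝ} {u₀ : V}

lemma continuous_quadratic_along_line (G : BilinForm ℝ V) (u₀ z : V) :
    Continuous fun r : ℝ => G (u₀ + r • z) (u₀ + r • z) := by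
  simp only [map_add, map_smul, LinearMap.add_apply, LinearMap.smul_apply, smul_eq_mul]
  fun_prop

lemma eventually_quadratic_pos_along_line (hu₀ : 0 < G u₀ u₀) (z : V) :
    ∀ᶠ r in 𝓝 (0 : ℝ), 0 < G (u₀ + r • z) (u₀ + r • z) :=
  (continuous_quadratic_along_line G u₀ z).continuousAt.eventually_const_lt (by simpa using hu₀)

lemma tendsto_div_sqrt_along_line (hu₀ : 0 < G u₀ u₀) (hβ : β u₀ = 0) (z : V) :
    Filter.Tendsto (fun r : ℝ => β (u₀ + r • z) / √(G (u₀ + r • z) (u₀ + r • z))) (𝓝 0) (𝓝 0) := by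
  have hnum : Continuous fun r : ℝ => β (u₀ + r • z) := by
    simp only [map_add, map_smul, smul_eq_mul]
    fun_prop
  have hcont := hnum.continuousAt.div (continuous_quadratic_along_line G u₀ z).sqrt.continuousAt
    (a := 0) (by simpa using (Real.sqrt_pos.2 hu₀).ne')
  simpa [ContinuousAt, hβ, Pi.div_def] using hcont

end

/-- For the first jet of `(α, β)` at a point, `S v y` standing for `∂_y b(v)` and `T u v w` for
`∂_w a(u, v)`: the coefficient of `φ² - sφφ'` in the equation of dual flatness for `α φ(β/α)`, in
the direction `v` and at the vector `y`. It is even in `y`. -/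
def evenPart (k₁ : ℝ) (β : V →ₗ[ℝ] ℝ) (S : BilinForm ℝ V) (T : V →ₗ[ℝ] BilinForm ℝ V)
    (v y : V) : ℝ :=
  2 * (T v y y - T y y v) + 2 * k₁ * (β y * (S v y - 2 * S y v) + β v * S y y)

/-- The coefficient of `(φφ' - sφ'² - sφφ'') / α³` in the same equation. It is odd in `y`. -/
def oddPart (k₂ k₃ : ℝ) (G : BilinForm ℝ V) (β : V →ₗ[ℝ] ℝ) (S : BilinForm ℝ V)
    (T : V →ₗ[ℝ] BilinForm ℝ V) (v y : V) : ℝ :=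
  2 * G y y ^ 2 * (S v y - 2 * S y v) + (G y y * β v - β y * G y v) * T y y y
    + 2 * G y y * G y v * S y y
    + 2 * β y * (k₂ * G y y - k₃ * β y ^ 2) * (β y * (S v y - 2 * S y v) + β v * S y y)

variable {k₁ k₂ k₃ : ℝ} {G : BilinForm ℝ V} {β : V →ₗ[ℝ] ℝ} {S : BilinForm ℝ V}
  {T : V →ₗ[ℝ] BilinForm ℝ V}

lemma evenPart_neg (v y : V) : evenPart k₁ β S T v (-y) = evenPart k₁ β S T v y := by
  simp only [evenPart, map_neg, LinearMap.neg_apply]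
  ring

lemma oddPart_neg (v y : V) : oddPart k₂ k₃ G β S T v (-y) = -oddPart k₂ k₃ G β S T v y := by
  simp only [oddPart, map_neg, LinearMap.neg_apply]
  ring

lemma analyticOnNhd_evenPart_along_line (v u₀ z : V) :
    AnalyticOnNhd ℝ (fun r : ℝ => evenPart k₁ β S T v (u₀ + r • z)) Set.univ := by
  simp only [evenPart, map_add, map_smul, LinearMap.add_apply, LinearMap.smul_apply, smul_eq_mul]
  intro r _
  fun_prop

lemma analyticOnNhd_oddPart_along_line (v u₀ z : V) :
    AnalyticOnNhd ℝ (fun r : ℝ => oddPart k₂ k₃ G β S T v (u₀ + r • z)) Set.univ := by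
  simp only [oddPart, map_add, map_smul, LinearMap.add_apply, LinearMap.smul_apply, smul_eq_mul]
  intro r _
  fun_prop

-- Adding and subtracting the equations at `w` and `-w` separates the two parts.
lemma evenPart_eq_zero_and_oddPart_eq_zero_of_neg {f g : ℝ → ℝ} {v w : V} (hw : 0 < G w w)
    (hdet : f (β w / √(G w w)) * g (-(β w / √(G w w)))
      + f (-(β w / √(G w w))) * g (β w / √(G w w)) ≠ 0)
    (h : ∀ y, y ≠ 0 → f (β y / √(G y y)) * evenPart k₁ β S T v y
      + g (β y / √(G y y)) / (G y y * √(G y y)) * oddPart k₂ k₃ G β S T v y = 0) :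
    evenPart k₁ β S T v w = 0 ∧ oddPart k₂ k₃ G β S T v w = 0 := by
  have hw0 : w ≠ 0 := by
    rintro rfl
    simp at hw
  have hpos := h w hw0
  have hneg := h (-w) (neg_ne_zero.2 hw0)
  simp only [evenPart_neg, oddPart_neg, map_neg, LinearMap.neg_apply, neg_neg, neg_div] at hneg
  set s := β w / √(G w w)
  have hα : 0 < G w w * √(G w w) := mul_pos hw (Real.sqrt_pos.2 hw)
  have heven : (f s * g (-s) + f (-s) * g s) * evenPart k₁ β S T v w = 0 := by
    linear_combination g (-s) * hpos + g s * hneg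
  have hodd : (f s * g (-s) + f (-s) * g s)
      * (oddPart k₂ k₃ G β S T v w / (G w w * √(G w w))) = 0 := by
    linear_combination f (-s) * hpos - f s * hneg
  have hquot := (mul_eq_zero.1 hodd).resolve_left hdet
  exact ⟨(mul_eq_zero.1 heven).resolve_left hdet,
    (div_eq_zero_iff.1 hquot).resolve_right hα.ne'⟩

/-
Near a null vector `u₀` of `β` the argument `β / α` is close to `0`, where `f` and `g` do not
vanish; the two parts are polynomial in `y`, so that it suffices to separate them there.
-/
lemma evenPart_eq_zero_and_oddPart_eq_zero (hG : ∀ v, v ≠ 0 → 0 < G v v) {u₀ : V} (hu₀ : u₀ ≠ 0)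
    (hβ : β u₀ = 0) {f g : ℝ → ℝ} (hf : ContinuousAt f 0) (hg : ContinuousAt g 0) (hf0 : f 0 ≠ 0)
    (hg0 : g 0 ≠ 0)
    (h : ∀ v y, y ≠ 0 → f (β y / √(G y y)) * evenPart k₁ β S T v y
      + g (β y / √(G y y)) / (G y y * √(G y y)) * oddPart k₂ k₃ G β S T v y = 0) (v y : V) :
    evenPart k₁ β S T v y = 0 ∧ oddPart k₂ k₃ G β S T v y = 0 := by
  have near : ∀ z, ∀ᶠ r in 𝓝 (0 : ℝ), evenPart k₁ β S T v (u₀ + r • z) = 0 ∧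
      oddPart k₂ k₃ G β S T v (u₀ + r • z) = 0 := by
    intro z
    filter_upwards [eventually_quadratic_pos_along_line (hG u₀ hu₀) z,
      (tendsto_div_sqrt_along_line (hG u₀ hu₀) hβ z).eventually
        (eventually_mul_neg_add_neg_mul_ne_zero hf hg hf0 hg0)] with r hr hdet
    exact evenPart_eq_zero_and_oddPart_eq_zero_of_neg hr hdet (h v)
  exact ⟨eq_zero_of_eventually_eq_zero_along_lines u₀ (analyticOnNhd_evenPart_along_line v u₀)
      (fun z => (near z).mono fun _ => And.left) y,
    eq_zero_of_eventually_eq_zero_along_lines u₀ (analyticOnNhd_oddPart_along_line v u₀)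
      (fun z => (near z).mono fun _ => And.right) y⟩

lemma orthogonal_sub_smul {u : V} (hu : G u u ≠ 0) (v : V) :
    G u (v - (G u v / G u u) • u) = 0 := by
  simp only [map_sub, map_smul, smul_eq_mul]
  field_simp
  ring

lemma apply_self_mul_eq_of_orthogonal (hGs : G.IsSymm) (hG : ∀ v, v ≠ 0 → 0 < G v v)
    (h : ∀ u v, G u v = 0 → S u v = 0) {u v : V} (huv : G u v = 0) :
    S u u * G v v = S v v * G u u := by
  have nonneg : ∀ w, 0 ≤ G w w := fun w => by
    by_cases hw : w = 0
    · simp [hw]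
    · exact (hG w hw).le
  have hvu : G v u = 0 := by rw [hGs.eq, huv]
  have hu := Real.sq_sqrt (nonneg u)
  have hv := Real.sq_sqrt (nonneg v)
  -- `|v| u + |u| v` and `|v| u - |u| v` are orthogonal.
  have := h (√(G v v) • u + √(G u u) • v) (√(G v v) • u - √(G u u) • v) (by
    simp only [map_add, map_sub, map_smul, LinearMap.add_apply, LinearMap.smul_apply, smul_eq_mul,
      huv, hvu]
    linear_combination G u u * hv - G v v * hu)
  simp only [map_add, map_sub, map_smul, LinearMap.add_apply, LinearMap.smul_apply, smul_eq_mul,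
    h u v huv, h v u hvu] at this
  linear_combination this - S u u * hv + S v v * hu

lemma exists_eq_smul_of_forall_orthogonal (hGs : G.IsSymm) (hG : ∀ v, v ≠ 0 → 0 < G v v)
    (h : ∀ u v, G u v = 0 → S u v = 0) : ∃ m : ℝ, S = m • G := by
  rcases subsingleton_or_nontrivial V with _ | _
  · exact ⟨0, LinearMap.ext fun u => by simp [Subsingleton.elim u 0]⟩
  obtain ⟨u₀, hu₀⟩ := exists_ne (0 : V)
  have hu₀' := hG u₀ hu₀
  set m := S u₀ u₀ / G u₀ u₀ with hm
  have apply_left : ∀ u v, u ≠ 0 → S u v * G u u = G u v * S u u := by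
    intro u v hu
    have := h u _ (orthogonal_sub_smul (hG u hu).ne' v)
    rw [map_sub, map_smul, smul_eq_mul, sub_eq_zero] at this
    have := (hG u hu).ne'
    rw [‹S u v = _›]
    field_simp
  have apply_self : ∀ v, S v v = m * G v v := by
    intro v
    set w := v - (G u₀ v / G u₀ u₀) • u₀ with hw
    have hort : G u₀ w = 0 := orthogonal_sub_smul hu₀'.ne' v
    have hort' : G w u₀ = 0 := by rw [hGs.eq, hort]
    have hSw : S w w = m * G w w := by
      have := apply_self_mul_eq_of_orthogonal hGs hG h hort
      rw [hm]
      field_simp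
      linear_combination -this
    have hv : v = (G u₀ v / G u₀ u₀) • u₀ + w := by rw [hw]; abel
    have hSu₀ : S u₀ u₀ = m * G u₀ u₀ := by rw [hm]; field_simp
    rw [hv]
    simp only [map_add, map_smul, LinearMap.add_apply, LinearMap.smul_apply, smul_eq_mul, hort,
      hort', h u₀ w hort, h w u₀ hort', hSw, hSu₀]
    ring
  refine ⟨m, LinearMap.ext fun u => LinearMap.ext fun v => ?_⟩
  by_cases hu : u = 0
  · simp [hu]
  refine mul_right_cancel₀ (hG u hu).ne' ?_
  rw [apply_left u v hu, apply_self, LinearMap.smul_apply, LinearMap.smul_apply, smul_eq_mul]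
  ring

/-- The shape of the first jet of `(α, β)` at a point (see `evenPart`) for which `α φ(β/α)` is
dually flat there: it depends only on a covector `θ` and a number `m`. -/
structure IsFlatJet (k₁ k₂ k₃ : ℝ) (G : BilinForm ℝ V) (β : V →ₗ[ℝ] ℝ) (S : BilinForm ℝ V)
    (T : V →ₗ[ℝ] BilinForm ℝ V) (θ : V →ₗ[ℝ] ℝ) (m : ℝ) : Prop where
  metric : ∀ u v w, T u v w = 4 * (θ u * G v w + θ v * G u w + θ w * G u v)
    + 2 * m * (k₁ * β w * G u v + 2 * k₃ * β u * β v * β w)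
  form : ∀ u v, S u v = 4 * θ u * β v + 2 * θ v * β u + m * (2 * G u v + (k₁ + 2 * k₂) * β u * β v)

namespace IsFlatJet

variable {θ : V →ₗ[ℝ] ℝ} {m : ℝ}

lemma evenPart_eq_zero (hGs : G.IsSymm) (h : IsFlatJet k₁ k₂ k₃ G β S T θ m) (v y : V) :
    evenPart k₁ β S T v y = 0 := by
  simp only [evenPart, h.metric, h.form, hGs.eq v y]
  ring

lemma oddPart_eq_zero (hGs : G.IsSymm) (h : IsFlatJet k₁ k₂ k₃ G β S T θ m) (v y : V) :
    oddPart k₂ k₃ G β S T v y = 0 := by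
  simp only [oddPart, h.metric, h.form, hGs.eq v y]
  ring

end IsFlatJet

lemma apply_eq_two_mul_of_oddPart_eq_zero (hG : ∀ v, v ≠ 0 → 0 < G v v)
    (hodd : ∀ v y, oddPart k₂ k₃ G β S T v y = 0) {v y : V} (hy : β y = 0) (hv : β v = 0)
    (hyv : G y v = 0) : S v y = 2 * S y v := by
  by_cases hy0 : y = 0
  · simp [hy0]
  have hyy := hG y hy0
  have hprod : 2 * G y y ^ 2 * (S v y - 2 * S y v) = 0 := by
    have := hodd v y
    simp only [oddPart, hy, hv, hyv] at this
    linear_combination this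
  exact sub_eq_zero.1 ((mul_eq_zero.1 hprod).resolve_left (by positivity))

lemma exists_eq_mul_on_ker_of_oddPart_eq_zero (hGs : G.IsSymm) (hG : ∀ v, v ≠ 0 → 0 < G v v)
    (hodd : ∀ v y, oddPart k₂ k₃ G β S T v y = 0) :
    ∃ m : ℝ, ∀ u v, β u = 0 → β v = 0 → S u v = m * G u v := by
  obtain ⟨m, hm⟩ := exists_eq_smul_of_forall_orthogonal (G := G.restrict (LinearMap.ker β))
    (S := S.restrict (LinearMap.ker β)) (hGs.restrict _)
    (fun v hv => hG v (by simpa using hv)) (by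
      rintro ⟨u, hu⟩ ⟨v, hv⟩ (huv : G u v = 0)
      have huv' := apply_eq_two_mul_of_oddPart_eq_zero hG hodd hv hu (by rw [hGs.eq, huv])
      have hvu' := apply_eq_two_mul_of_oddPart_eq_zero hG hodd hu hv huv
      change S u v = 0
      linarith)
  exact ⟨m, fun u v hu hv => LinearMap.congr_fun₂ hm ⟨u, hu⟩ ⟨v, hv⟩⟩

section

variable {e : V}

lemma apply_gradient_of_oddPart_eq_zero (he : ∀ v, G e v = β v) (he0 : 0 < β e)
    (hQ : 0 < deformQ k₂ k₃ (β e))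
    (hodd : ∀ v y, oddPart k₂ k₃ G β S T v y = 0) (v : V) :
    β e * (S v e - 2 * S e v) + β v * S e e = 0 := by
  have hprod : (2 * β e * deformQ k₂ k₃ (β e)) * (β e * (S v e - 2 * S e v) + β v * S e e) = 0 := by
    have := hodd v e
    simp only [oddPart, he] at this
    rw [deformQ]
    linear_combination this
  exact (mul_eq_zero.1 hprod).resolve_left (by positivity)

lemma exists_form_eq_of_oddPart_eq_zero (he : ∀ v, G e v = β v) (he0 : 0 < β e)
    (hGs : G.IsSymm) (hG : ∀ v, v ≠ 0 → 0 < G v v)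
    (hQ : 0 < deformQ k₂ k₃ (β e)) (hodd : ∀ v y, oddPart k₂ k₃ G β S T v y = 0) :
    ∃ (θ : V →ₗ[ℝ] ℝ) (m : ℝ), ∀ u v,
      S u v = 4 * θ u * β v + 2 * θ v * β u + m * (2 * G u v + (k₁ + 2 * k₂) * β u * β v) := by
  obtain ⟨m, hm⟩ : ∃ m : ℝ, ∀ u v, β u = 0 → β v = 0 → S u v = 2 * m * G u v := by
    obtain ⟨m', hm'⟩ := exists_eq_mul_on_ker_of_oddPart_eq_zero hGs hG hodd
    exact ⟨m' / 2, fun u v hu hv => by rw [hm' u v hu hv]; ring⟩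
  set t := β e with ht
  -- `θe` is going to be `θ e`; it and `θ` are solved for from the claimed formula for `S e`.
  obtain ⟨θe, hθe⟩ : ∃ θe : ℝ, 6 * t * θe = S e e - m * (2 * t + (k₁ + 2 * k₂) * t ^ 2) :=
    ⟨(S e e - m * (2 * t + (k₁ + 2 * k₂) * t ^ 2)) / (6 * t), by field_simp⟩
  obtain ⟨θ, hθ⟩ : ∃ θ : V →ₗ[ℝ] ℝ, ∀ v,
      2 * t * θ v = S e v - (4 * θe + m * (2 + (k₁ + 2 * k₂) * t)) * β v := by
    refine ⟨(1 / (2 * t)) • (S e - (4 * θe + m * (2 + (k₁ + 2 * k₂) * t)) • β), fun v => ?_⟩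
    simp only [LinearMap.smul_apply, LinearMap.sub_apply, smul_eq_mul]
    field_simp
  refine ⟨θ, m, fun u v => mul_left_cancel₀ (pow_pos he0 2).ne' ?_⟩
  have proj_mem_ker : ∀ w, β (w - (β w / t) • e) = 0 := fun w => by
    simp only [map_sub, map_smul, smul_eq_mul, ← ht]
    field_simp
    ring
  have hker := hm _ _ (proj_mem_ker u) (proj_mem_ker v)
  simp only [map_sub, map_smul, smul_eq_mul, LinearMap.sub_apply, LinearMap.smul_apply, he,
    hGs.eq u e, ← ht] at hker
  field_simp at hker
  linear_combination hker + β v * apply_gradient_of_oddPart_eq_zero he he0 hQ hodd u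
    - 2 * t * β v * hθ u - t * β u * hθ v + 2 * β u * β v * hθe

lemma apply_self_of_oddPart_eq_zero (he : ∀ v, G e v = β v) (he0 : 0 < β e)
    (hGs : G.IsSymm) (hG : ∀ v, v ≠ 0 → 0 < G v v) {u₀ : V}
    (hu₀ : u₀ ≠ 0) (hβ : β u₀ = 0) (hodd : ∀ v y, oddPart k₂ k₃ G β S T v y = 0)
    {θ : V →ₗ[ℝ] ℝ} {m : ℝ}
    (hS : ∀ u v, S u v
      = 4 * θ u * β v + 2 * θ v * β u + m * (2 * G u v + (k₁ + 2 * k₂) * β u * β v)) (y : V) :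
    T y y y = 12 * θ y * G y y + 2 * m * (k₁ * β y * G y y + 2 * k₃ * β y ^ 3) := by
  refine sub_eq_zero.1 (eq_zero_of_eventually_eq_zero_along_lines u₀ (P := fun y => T y y y
    - (12 * θ y * G y y + 2 * m * (k₁ * β y * G y y + 2 * k₃ * β y ^ 3)))
    (fun z r _ => ?_) (fun z => ?_) y)
  · simp only [map_add, map_smul, LinearMap.add_apply, LinearMap.smul_apply, smul_eq_mul]
    fun_prop
  -- The equation in the direction `e` determines `T y y y` unless `y` is parallel to `e`.
  have hdisc : ∀ᶠ r in 𝓝 (0 : ℝ),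
      G (u₀ + r • z) (u₀ + r • z) * β e - β (u₀ + r • z) ^ 2 ≠ 0 := by
    refine ContinuousAt.eventually_ne (Continuous.continuousAt ?_) ?_
    · simp only [map_add, map_smul, LinearMap.add_apply, LinearMap.smul_apply, smul_eq_mul]
      fun_prop
    · simpa [hβ] using ⟨(hG u₀ hu₀).ne', he0.ne'⟩
  filter_upwards [hdisc] with r hr
  have := hodd e (u₀ + r • z)
  simp only [oddPart, hS] at this
  rw [hGs.eq _ e, he] at this
  refine (mul_eq_zero.1 ?_).resolve_left hr
  linear_combination this

end

/-
`T` is symmetric in its first two arguments, and `evenPart = 0` compares `T v y y` with `T y y v`;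
polarizing the cubic form `T y y y` twice therefore recovers `T`.
-/
lemma metric_eq_of_evenPart_eq_zero (hGs : G.IsSymm) (hTs : ∀ u v w, T u v w = T v u w)
    (heven : ∀ v y, evenPart k₁ β S T v y = 0) {θ : V →ₗ[ℝ] ℝ} {m : ℝ}
    (hS : ∀ u v, S u v
      = 4 * θ u * β v + 2 * θ v * β u + m * (2 * G u v + (k₁ + 2 * k₂) * β u * β v))
    (hT : ∀ y, T y y y = 12 * θ y * G y y + 2 * m * (k₁ * β y * G y y + 2 * k₃ * β y ^ 3))
    (u v w : V) :
    T u v w = 4 * (θ u * G v w + θ v * G u w + θ w * G u v)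
      + 2 * m * (k₁ * β w * G u v + 2 * k₃ * β u * β v * β w) := by
  have hswap : ∀ v y, T y v y = T y y v - k₁ * m * (2 * G y y * β v - 2 * β y * G y v) := by
    intro v y
    have := heven v y
    simp only [evenPart, hS, hGs.eq v y, hTs v y y] at this
    linear_combination this / 2
  have hdiag : ∀ v w, T v v w = 4 * (2 * θ v * G v w + θ w * G v v)
      + 2 * m * (k₁ * β w * G v v + 2 * k₃ * β v ^ 2 * β w) := by
    intro v w
    have hadd := hT (w + v)
    have hsub := hT (w - v)
    simp only [map_add, map_sub, LinearMap.add_apply, LinearMap.sub_apply, hGs.eq w v] at hadd hsub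
    linear_combination hadd / 6 + hsub / 6 - hT w / 3 - (2 / 3) * hswap w v - (1 / 3) * hTs w v v
  have hadd := hdiag (u + v) w
  have hsub := hdiag (u - v) w
  simp only [map_add, map_sub, LinearMap.add_apply, LinearMap.sub_apply, hGs.eq v u] at hadd hsub
  linear_combination hadd / 4 - hsub / 4 - hTs v u w / 2

lemma exists_isFlatJet (hGs : G.IsSymm) (hG : ∀ v, v ≠ 0 → 0 < G v v)
    (hTs : ∀ u v w, T u v w = T v u w) {u₀ e : V} (hu₀ : u₀ ≠ 0) (hβ : β u₀ = 0)
    (he : ∀ v, G e v = β v) (he0 : 0 < β e) (hQ : 0 < deformQ k₂ k₃ (β e))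
    (heven : ∀ v y, evenPart k₁ β S T v y = 0) (hodd : ∀ v y, oddPart k₂ k₃ G β S T v y = 0) :
    ∃ θ m, IsFlatJet k₁ k₂ k₃ G β S T θ m := by
  obtain ⟨θ, m, hS⟩ := exists_form_eq_of_oddPart_eq_zero he he0 hGs hG hQ hodd
  exact ⟨θ, m, metric_eq_of_evenPart_eq_zero hGs hTs heven hS
    (apply_self_of_oddPart_eq_zero he he0 hGs hG hu₀ hβ hodd hS), hS⟩

end FlatJets

section DeformationFactor

/-- `f` is positive and smooth at `t`, and its logarithmic derivative there is `l`. -/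
structure HasLogDerivAt (f : ℝ → ℝ) (l t : ℝ) : Prop where
  pos : 0 < f t
  contDiffAt : ContDiffAt ℝ ∞ f t
  hasDerivAt : HasDerivAt f (f t * l) t

namespace HasLogDerivAt

variable {f g : ℝ → ℝ} {l m t : ℝ}

lemma of_hasDerivAt {f' : ℝ} (hpos : 0 < f t) (hf : ContDiffAt ℝ ∞ f t) (hf' : HasDerivAt f f' t)
    (hl : f t * l = f') : HasLogDerivAt f l t :=
  ⟨hpos, hf, hl ▸ hf'⟩

lemma exp_comp (hf : ContDiffAt ℝ ∞ f t) (hf' : HasDerivAt f l t) :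
    HasLogDerivAt (fun x => Real.exp (f x)) l t :=
  ⟨Real.exp_pos _, hf.exp, hf'.exp⟩

lemma const_mul {c : ℝ} (hc : 0 < c) (hf : HasLogDerivAt f l t) :
    HasLogDerivAt (fun x => c * f x) l t :=
  of_hasDerivAt (mul_pos hc hf.pos) (contDiffAt_const.mul hf.contDiffAt)
    (hf.hasDerivAt.const_mul c) (by ring)

lemma rpow_const (hf : HasLogDerivAt f l t) (p : ℝ) :
    HasLogDerivAt (fun x => f x ^ p) (p * l) t := by
  refine of_hasDerivAt (Real.rpow_pos_of_pos hf.pos p)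
    (hf.contDiffAt.rpow_const_of_ne hf.pos.ne') (hf.hasDerivAt.rpow_const (Or.inl hf.pos.ne')) ?_
  have := hf.pos.ne'
  rw [Real.rpow_sub_one hf.pos.ne']
  field_simp

lemma div (hf : HasLogDerivAt f l t) (hg : HasLogDerivAt g m t) :
    HasLogDerivAt (fun x => f x / g x) (l - m) t := by
  refine of_hasDerivAt (div_pos hf.pos hg.pos) (hf.contDiffAt.div hg.contDiffAt hg.pos.ne')
    (hf.hasDerivAt.div hg.hasDerivAt hg.pos.ne') ?_
  have := hg.pos.ne'
  field_simp

lemma congr_deriv (hf : HasLogDerivAt f l t) (h : l = m) : HasLogDerivAt f m t :=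
  h ▸ hf

end HasLogDerivAt

variable {k₁ k₂ k₃ t : ℝ}

lemma contDiff_deformQ : ContDiff ℝ ∞ (deformQ k₂ k₃) := by
  unfold deformQ
  fun_prop

lemma hasDerivAt_const_add_mul (c d t : ℝ) : HasDerivAt (fun x => c + d * x) d t := by
  simpa using ((hasDerivAt_id t).const_mul d).const_add c

lemma hasDerivAt_const_sub_mul (c d t : ℝ) : HasDerivAt (fun x => c - d * x) (-d) t := by
  simpa using ((hasDerivAt_id t).const_mul d).const_sub c

lemma hasLogDerivAt_deformQ (h : 0 < deformQ k₂ k₃ t) :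
    HasLogDerivAt (deformQ k₂ k₃) ((k₂ - 2 * k₃ * t) / deformQ k₂ k₃ t) t := by
  refine .of_hasDerivAt h contDiff_deformQ.contDiffAt
    ((hasDerivAt_const_add_mul 1 k₂ t).sub (((hasDerivAt_id t).pow 2).const_mul k₃)) ?_
  rw [mul_div_cancel₀ _ h.ne']
  simp only [id, Nat.cast_ofNat, Nat.add_one_sub_one, pow_one, mul_one]
  ring

lemma hasLogDerivAt_const_add_mul {c d : ℝ} (h : 0 < c + d * t) :
    HasLogDerivAt (fun x => c + d * x) (d / (c + d * t)) t :=
  .of_hasDerivAt h (by fun_prop) (hasDerivAt_const_add_mul c d t) (by field_simp)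

/-- `f` is a deformation factor at `t`: the only properties of `η` that the deformation uses are
its positivity, its smoothness and this logarithmic derivative. -/
abbrev IsFactorAt (k₁ k₂ k₃ : ℝ) (f : ℝ → ℝ) (t : ℝ) : Prop :=
  HasLogDerivAt f ((k₁ - k₂ + k₃ * t) / (4 * deformQ k₂ k₃ t)) t

lemma isFactorAt_eta_zero_zero : IsFactorAt k₁ 0 0 (eta k₁ 0 0) t := by
  have heta : eta k₁ 0 0 = fun t => Real.exp (k₁ * t / 4) := by
    funext t
    simp only [eta, if_true]
  rw [heta]
  refine (HasLogDerivAt.exp_comp (by fun_prop)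
    (((hasDerivAt_id t).const_mul k₁).div_const 4)).congr_deriv ?_
  simp [deformQ]

lemma isFactorAt_eta_zero (hk₂ : k₂ ≠ 0) (hQ : 0 < deformQ k₂ 0 t) :
    IsFactorAt k₁ k₂ 0 (eta k₁ k₂ 0) t := by
  have heta : eta k₁ k₂ 0 = fun t => (1 + k₂ * t) ^ ((k₁ - k₂) / (4 * k₂)) := by
    funext t
    simp only [eta, if_true, if_neg hk₂]
  have hQt : deformQ k₂ 0 t = 1 + k₂ * t := by rw [deformQ]; ring
  rw [hQt] at hQ
  rw [heta]
  refine ((hasLogDerivAt_const_add_mul hQ).rpow_const _).congr_deriv ?_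
  rw [hQt]
  field_simp
  ring

section PositiveDiscriminant

variable {r : ℝ}

lemma linear_mul_linear_eq_deformQ (hr : r ^ 2 = k₂ ^ 2 + 4 * k₃) (t : ℝ) :
    (r - k₂ + 2 * k₃ * t) * (r + k₂ - 2 * k₃ * t) = 4 * k₃ * deformQ k₂ k₃ t := by
  rw [deformQ]
  linear_combination hr

-- `deformQ` is positive at `0` and at `t`, so that both cross-ratio factors have the same sign.
lemma hasLogDerivAt_crossRatio (hk₃ : k₃ ≠ 0) (hr : r ^ 2 = k₂ ^ 2 + 4 * k₃)
    (hQ : 0 < deformQ k₂ k₃ t) :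
    HasLogDerivAt
      (fun t => (r + k₂) / (r - k₂) * ((r - k₂ + 2 * k₃ * t) / (r + k₂ - 2 * k₃ * t)))
      (r / deformQ k₂ k₃ t) t := by
  have h₀ : (r - k₂) * (r + k₂) = 4 * k₃ := by linear_combination hr
  have hₜ := linear_mul_linear_eq_deformQ hr t
  have hₜ0 : 4 * k₃ * deformQ k₂ k₃ t ≠ 0 := mul_ne_zero (by positivity) hQ.ne'
  have hsub : r - k₂ ≠ 0 := fun h => hk₃ (by simpa [h] using h₀)
  have hadd : r + k₂ ≠ 0 := fun h => hk₃ (by simpa [h] using h₀)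
  have : r - k₂ + 2 * k₃ * t ≠ 0 := left_ne_zero_of_mul (hₜ ▸ hₜ0)
  have hden : r + k₂ - 2 * k₃ * t ≠ 0 := right_ne_zero_of_mul (hₜ ▸ hₜ0)
  have hpos : 0 < (r + k₂) / (r - k₂) * ((r - k₂ + 2 * k₃ * t) / (r + k₂ - 2 * k₃ * t)) := by
    have : (r + k₂) / (r - k₂) * ((r - k₂ + 2 * k₃ * t) / (r + k₂ - 2 * k₃ * t))
        = 16 * k₃ ^ 2 * deformQ k₂ k₃ t / ((r - k₂) * (r + k₂ - 2 * k₃ * t)) ^ 2 := by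
      field_simp
      linear_combination (r - k₂ + 2 * k₃ * t) * (r + k₂ - 2 * k₃ * t) * h₀ + 4 * k₃ * hₜ
    rw [this]
    positivity
  refine .of_hasDerivAt hpos ?_ (((hasDerivAt_const_add_mul _ _ t).div
    (hasDerivAt_const_sub_mul _ _ t) hden).const_mul _) ?_
  · exact contDiffAt_const.mul (ContDiffAt.div (by fun_prop) (by fun_prop) hden)
  · have := hQ.ne'
    field_simp
    linear_combination r * hₜ

lemma isFactorAt_eta_of_discrim_pos (hk₃ : k₃ ≠ 0) (hΔ : 0 < k₂ ^ 2 + 4 * k₃)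
    (hQ : 0 < deformQ k₂ k₃ t) : IsFactorAt k₁ k₂ k₃ (eta k₁ k₂ k₃) t := by
  set r := √(k₂ ^ 2 + 4 * k₃) with hr
  have hr0 : 0 < r := Real.sqrt_pos.2 hΔ
  have heta : eta k₁ k₂ k₃ = fun t =>
      ((r + k₂) / (r - k₂) * ((r - k₂ + 2 * k₃ * t) / (r + k₂ - 2 * k₃ * t)))
        ^ ((2 * k₁ - k₂) / (8 * r)) / (deformQ k₂ k₃ t) ^ (1 / 8 : ℝ) := by
    funext t
    simp only [eta, if_neg hk₃, if_pos hΔ, ← hr]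
  rw [heta]
  refine (((hasLogDerivAt_crossRatio hk₃ (Real.sq_sqrt hΔ.le) hQ).rpow_const _).div
    ((hasLogDerivAt_deformQ hQ).rpow_const _)).congr_deriv ?_
  have := hQ.ne'
  field_simp
  ring

end PositiveDiscriminant

lemma isFactorAt_eta_of_discrim_eq_zero (hk₃ : k₃ ≠ 0) (hΔ : k₂ ^ 2 + 4 * k₃ = 0)
    (h : 0 < 2 + k₂ * t) : IsFactorAt k₁ k₂ k₃ (eta k₁ k₂ k₃) t := by
  have heta : eta k₁ k₂ k₃ = fun t => (2 : ℝ) ^ (1 / 4 : ℝ)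
      * Real.exp ((k₂ - 2 * k₁) / (2 * k₂) * (1 / (2 + k₂ * t) - 1 / 2))
      / (2 + k₂ * t) ^ (1 / 4 : ℝ) := by
    funext t
    simp only [eta, if_neg hk₃, hΔ, lt_irrefl, if_true, if_false]
  have hk₃' : k₃ = -k₂ ^ 2 / 4 := by linarith
  have hk₂ : k₂ ≠ 0 := fun h0 => hk₃ (by simp [hk₃', h0])
  have hinv : HasDerivAt (fun t => 1 / (2 + k₂ * t)) (-k₂ / (2 + k₂ * t) ^ 2) t := by
    simpa only [one_div] using (hasDerivAt_const_add_mul 2 k₂ t).fun_inv h.ne'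
  have hinv' : ContDiffAt ℝ ∞ (fun t => 1 / (2 + k₂ * t)) t :=
    contDiffAt_const.div (by fun_prop) h.ne'
  rw [heta]
  refine (((HasLogDerivAt.exp_comp (contDiffAt_const.mul (hinv'.sub contDiffAt_const))
    ((hinv.sub_const _).const_mul _)).const_mul (by positivity)).div
      ((hasLogDerivAt_const_add_mul h).rpow_const _)).congr_deriv ?_
  have hQ : deformQ k₂ k₃ t = (2 + k₂ * t) ^ 2 / 4 := by
    rw [deformQ, hk₃']
    ring
  rw [hQ, hk₃']
  field_simp
  ring

lemma hasDerivAt_arctan_of_discrim {p : ℝ} (hp : 0 < p) (hp' : p ^ 2 = -(k₂ ^ 2 + 4 * k₃))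
    (hQ : 0 < deformQ k₂ k₃ t) :
    HasDerivAt (fun t => Real.arctan ((k₂ - 2 * k₃ * t) / p)) (p / (2 * deformQ k₂ k₃ t)) t := by
  refine ((hasDerivAt_const_sub_mul k₂ (2 * k₃) t).div_const p).arctan.congr_deriv ?_
  have hk₃ : k₃ ≠ 0 := by
    rintro rfl
    nlinarith [sq_nonneg k₂, pow_pos hp 2]
  have hone : 1 + ((k₂ - 2 * k₃ * t) / p) ^ 2 = -4 * k₃ * deformQ k₂ k₃ t / p ^ 2 := by
    rw [deformQ]
    field_simp
    linear_combination hp'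
  rw [hone]
  field_simp
  ring

lemma isFactorAt_eta_of_discrim_neg (hΔ : k₂ ^ 2 + 4 * k₃ < 0) (hQ : 0 < deformQ k₂ k₃ t) :
    IsFactorAt k₁ k₂ k₃ (eta k₁ k₂ k₃) t := by
  have hk₃ : k₃ ≠ 0 := by
    rintro rfl
    nlinarith [sq_nonneg k₂]
  set p := √(-(k₂ ^ 2 + 4 * k₃)) with hp
  have hp0 : 0 < p := Real.sqrt_pos.2 (by linarith)
  have hp2 : p ^ 2 = -(k₂ ^ 2 + 4 * k₃) := Real.sq_sqrt (by linarith)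
  have heta : eta k₁ k₂ k₃ = fun t => Real.exp ((2 * k₁ - k₂) / (4 * p) *
      (Real.arctan ((k₂ - 2 * k₃ * t) / p) - Real.arctan (k₂ / p)))
      / (deformQ k₂ k₃ t) ^ (1 / 8 : ℝ) := by
    funext t
    simp only [eta, if_neg hk₃, if_neg hΔ.not_gt, if_neg hΔ.ne, ← hp]
  rw [heta]
  have hsmooth : ContDiffAt ℝ ∞ (fun t => Real.arctan ((k₂ - 2 * k₃ * t) / p)) t :=
    ContDiffAt.arctan (by fun_prop)
  refine ((HasLogDerivAt.exp_comp (contDiffAt_const.mul (hsmooth.sub contDiffAt_const))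
    (((hasDerivAt_arctan_of_discrim hp0 hp2 hQ).sub_const _).const_mul _)).div
      ((hasLogDerivAt_deformQ hQ).rpow_const _)).congr_deriv ?_
  have := hQ.ne'
  field_simp
  ring

lemma isFactorAt_eta (h : Admissible k₂ k₃ t) : IsFactorAt k₁ k₂ k₃ (eta k₁ k₂ k₃) t := by
  by_cases hk₃ : k₃ = 0
  · subst hk₃
    by_cases hk₂ : k₂ = 0
    · subst hk₂
      exact isFactorAt_eta_zero_zero
    · exact isFactorAt_eta_zero hk₂ h.1
  rcases lt_trichotomy (k₂ ^ 2 + 4 * k₃) 0 with hΔ | hΔ | hΔ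
  · exact isFactorAt_eta_of_discrim_neg hΔ h.1
  · exact isFactorAt_eta_of_discrim_eq_zero hk₃ hΔ (h.2 hk₃ hΔ)
  · exact isFactorAt_eta_of_discrim_pos hk₃ hΔ h.1

end DeformationFactor

section PointwiseForms

variable {n : ℕ} {a a' : (Fin n → ℝ) → Matrix (Fin n) (Fin n) ℝ} {b b' : (Fin n → ℝ) → Fin n → ℝ}
  {x : Fin n → ℝ}

/-- The bilinear form `a_ij(x) uⁱ vʲ`. -/
abbrev metricAt (a : (Fin n → ℝ) → Matrix (Fin n) (Fin n) ℝ) (x : Fin n → ℝ) :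
    BilinForm ℝ (Fin n → ℝ) :=
  Matrix.toBilin' (a x)

/-- The linear form `b_i(x) vⁱ`. -/
abbrev formAt (b : (Fin n → ℝ) → Fin n → ℝ) (x : Fin n → ℝ) : (Fin n → ℝ) →ₗ[ℝ] ℝ :=
  dotProductBilin ℝ ℝ (b x)

lemma beta_eq_formAt (y : Fin n → ℝ) : beta b x y = formAt b x y := rfl

lemma alpha_eq_sqrt (y : Fin n → ℝ) : alpha a x y = √(metricAt a x y y) := by
  rw [Matrix.toBilin'_apply', alpha]

lemma metricAt_isSymm (h : (a x).PosDef) : (metricAt a x).IsSymm :=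
  Matrix.isSymm_toBilin'_iff_isSymm.2 (by
    rw [Matrix.IsSymm, ← Matrix.conjTranspose_eq_transpose_of_trivial, h.isHermitian.eq])

lemma metricAt_pos (h : (a x).PosDef) (v : Fin n → ℝ) (hv : v ≠ 0) : 0 < metricAt a x v v := by
  simpa [Matrix.toBilin'_apply'] using h.dotProduct_mulVec_pos hv

lemma metricAt_nonneg (h : (a x).PosDef) (v : Fin n → ℝ) : 0 ≤ metricAt a x v v := by
  simpa [Matrix.toBilin'_apply'] using h.posSemidef.dotProduct_mulVec_nonneg v

lemma posDef_of_metricAt (hs : (metricAt a x).IsSymm) (h : ∀ v, v ≠ 0 → 0 < metricAt a x v v) :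
    (a x).PosDef := by
  refine .of_dotProduct_mulVec_pos ?_ fun v hv => by simpa [Matrix.toBilin'_apply'] using h v hv
  rw [Matrix.IsHermitian, Matrix.conjTranspose_eq_transpose_of_trivial,
    (Matrix.isSymm_toBilin'_iff_isSymm.1 hs).eq]

lemma alpha_sq (h : (a x).PosDef) (y : Fin n → ℝ) : alpha a x y ^ 2 = metricAt a x y y := by
  rw [alpha_eq_sqrt, Real.sq_sqrt (metricAt_nonneg h y)]

lemma metricAt_raise (h : (a x).PosDef) (ξ v : Fin n → ℝ) :
    metricAt a x v (raise a x ξ) = dotProductBilin ℝ ℝ ξ v := by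
  rw [Matrix.toBilin'_apply', raise, Matrix.mulVec_mulVec,
    Matrix.mul_nonsing_inv _ h.det_pos.ne'.isUnit, Matrix.one_mulVec, dotProduct_comm,
    dotProductBilin_apply_apply]

lemma metricAt_raise_left (h : (a x).PosDef) (ξ v : Fin n → ℝ) :
    metricAt a x (raise a x ξ) v = dotProductBilin ℝ ℝ ξ v := by
  rw [(metricAt_isSymm h).eq, metricAt_raise h]

lemma eq_of_metricAt_eq (h : (a x).PosDef) {u v : Fin n → ℝ}
    (huv : ∀ z, metricAt a x z u = metricAt a x z v) : u = v := by
  have hsub : metricAt a x (u - v) (u - v) = 0 := by rw [map_sub, huv, sub_self]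
  exact sub_eq_zero.1 (by_contra fun hne => (metricAt_pos h _ hne).ne' hsub)

lemma normSq_eq_formAt : normSq a b x = formAt b x (raise a x (b x)) := rfl

lemma metricAt_raise_self (h : (a x).PosDef) :
    metricAt a x (raise a x (b x)) (raise a x (b x)) = normSq a b x :=
  metricAt_raise h _ _

lemma normSq_pos (h : (a x).PosDef) (hb : b x ≠ 0) : 0 < normSq a b x := by
  rw [← metricAt_raise_self h]
  refine metricAt_pos h _ fun h0 => hb (dotProduct_eq_zero _ fun v => ?_)
  rw [← dotProductBilin_apply_apply (R := ℝ) (S := ℝ), ← metricAt_raise_left h, h0, map_zero,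
    LinearMap.zero_apply]

lemma formAt_sq_le (h : (a x).PosDef) (y : Fin n → ℝ) :
    formAt b x y ^ 2 ≤ normSq a b x * metricAt a x y y := by
  have := (metricAt a x).apply_sq_le_of_symm (metricAt_nonneg h) ⟨(metricAt_isSymm h).eq⟩
    (raise a x (b x)) y
  rwa [metricAt_raise_left h, metricAt_raise_self h] at this

lemma two_mul_formAt_sub_metricAt_le (h : (a x).PosDef) (v : Fin n → ℝ) :
    2 * formAt b x v - metricAt a x v v ≤ normSq a b x := by
  have h0 := metricAt_nonneg h (v - raise a x (b x))
  simp only [map_sub, LinearMap.sub_apply, metricAt_raise h, metricAt_raise_left h,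
    ← normSq_eq_formAt] at h0
  linarith

/-- Sherman–Morrison: the inverse of `l (a + κ b ⊗ b)` sends `b` to `b♯ / (l (1 + κ ‖b‖²))`. -/
lemma normSq_rankOne {l κ μ : ℝ} (h : (a x).PosDef) (h' : (a' x).PosDef)
    (ha : ∀ u v, metricAt a' x u v = l * (metricAt a x u v + κ * (formAt b x u * formAt b x v)))
    (hb : ∀ v, formAt b' x v = μ * formAt b x v) (hl : l ≠ 0)
    (hκ : 1 + κ * normSq a b x ≠ 0) :
    normSq a' b' x = μ ^ 2 * normSq a b x / (l * (1 + κ * normSq a b x)) := by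
  set e := raise a x (b x)
  have hbe : formAt b x e = normSq a b x := normSq_eq_formAt.symm
  have hraise : raise a' x (b' x) = (μ / (l * (1 + κ * normSq a b x))) • e := by
    refine eq_of_metricAt_eq h' fun v => ?_
    rw [metricAt_raise h', map_smul, ha, hbe, metricAt_raise h, smul_eq_mul, hb]
    field_simp
  rw [normSq_eq_formAt, hraise, hb, map_smul, hbe, smul_eq_mul]
  ring

end PointwiseForms

section PartialDerivatives

variable {n : ℕ} {f g : (Fin n → ℝ) → ℝ} {x : Fin n → ℝ} {k : Fin n}

lemma pd_congr (h : f =ᶠ[𝓝 x] g) : pd k f x = pd k g x := by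
  rw [pd, pd, h.fderiv_eq]

lemma pd_eq_of_hasFDerivAt {f' : (Fin n → ℝ) →L[ℝ] ℝ} (h : HasFDerivAt f f' x) (k : Fin n) :
    pd k f x = f' (Pi.single k 1) := by
  rw [pd, h.fderiv]

lemma sum_apply_single_mul (L : (Fin n → ℝ) →ₗ[ℝ] ℝ) (y : Fin n → ℝ) :
    ∑ k, L (Pi.single k 1) * y k = L y := by
  conv_rhs => rw [← Finset.univ_sum_single y, map_sum]
  refine Finset.sum_congr rfl fun k _ => ?_
  rw [mul_comm, ← smul_eq_mul, ← map_smul, ← Pi.single_smul, smul_eq_mul, mul_one]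

lemma differentiableAt_of_smoothOn {E : Type*} [NormedAddCommGroup E] [NormedSpace ℝ E] {f : E → ℝ}
    {U : Set E} {x : E} (hU : IsOpen U) (hf : ContDiffOn ℝ ∞ f U) (hx : x ∈ U) :
    DifferentiableAt ℝ f x :=
  (hf.contDiffAt (hU.mem_nhds hx)).differentiableAt (by simp)

end PartialDerivatives

section FirstJets

variable {n : ℕ} {U : Set (Fin n → ℝ)} {a : (Fin n → ℝ) → Matrix (Fin n) (Fin n) ℝ}
  {b : (Fin n → ℝ) → Fin n → ℝ} {x : Fin n → ℝ}

/-- The derivative `∂_k b_i uⁱ wᵏ` at `x`; the last argument is the direction of the derivative. -/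
def formJet (b : (Fin n → ℝ) → Fin n → ℝ) (x : Fin n → ℝ) : BilinForm ℝ (Fin n → ℝ) :=
  Fintype.linearCombination ℝ fun i => (fderiv ℝ (fun x' => b x' i) x).toLinearMap

/-- The derivative `∂_k a_ij uⁱ vʲ wᵏ` at `x`; the last argument is the direction of the
derivative. -/
def metricJet (a : (Fin n → ℝ) → Matrix (Fin n) (Fin n) ℝ) (x : Fin n → ℝ) :
    (Fin n → ℝ) →ₗ[ℝ] BilinForm ℝ (Fin n → ℝ) :=
  Fintype.linearCombination ℝ fun i => formJet (fun x' => a x' i) x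

@[simp] lemma formJet_single (i k : Fin n) :
    formJet b x (Pi.single i 1) (Pi.single k 1) = pd k (fun x' => b x' i) x := by
  rw [formJet, Fintype.linearCombination_apply_single, one_smul]
  rfl

@[simp] lemma metricJet_single (i j k : Fin n) :
    metricJet a x (Pi.single i 1) (Pi.single j 1) (Pi.single k 1)
      = pd k (fun x' => a x' i j) x := by
  rw [metricJet, Fintype.linearCombination_apply_single, one_smul, formJet_single]

lemma hasFDerivAt_formAt (hb : ∀ i, DifferentiableAt ℝ (fun x' => b x' i) x) (u : Fin n → ℝ) :
    HasFDerivAt (fun x' => formAt b x' u) (formJet b x u).toContinuousLinearMap x := by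
  refine (HasFDerivAt.fun_sum (u := Finset.univ)
    fun i _ => (hb i).hasFDerivAt.mul_const (u i)).congr_fderiv ?_
  ext w
  simp [formJet, Fintype.linearCombination_apply]

lemma hasFDerivAt_metricAt (ha : ∀ i j, DifferentiableAt ℝ (fun x' => a x' i j) x)
    (u v : Fin n → ℝ) :
    HasFDerivAt (fun x' => metricAt a x' u v) (metricJet a x u v).toContinuousLinearMap x := by
  have hrow (i : Fin n) := (hasFDerivAt_formAt (ha i) v).const_mul (u i)
  have hsum := HasFDerivAt.fun_sum (u := Finset.univ) fun i _ => hrow i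
  simp only [Matrix.toBilin'_apply', dotProduct, Matrix.mulVec]
  refine hsum.congr_fderiv ?_
  ext w
  simp [metricJet, Fintype.linearCombination_apply]

lemma IsOneFormOn.hasFDerivAt (hU : IsOpen U) (hb : IsOneFormOn U b) (hx : x ∈ U)
    (u : Fin n → ℝ) :
    HasFDerivAt (fun x' => formAt b x' u) (formJet b x u).toContinuousLinearMap x :=
  hasFDerivAt_formAt (fun i => differentiableAt_of_smoothOn hU (hb i) hx) u

namespace IsRiemannianMetricOn

lemma hasFDerivAt (hU : IsOpen U) (ha : IsRiemannianMetricOn U a) (hx : x ∈ U)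
    (u v : Fin n → ℝ) :
    HasFDerivAt (fun x' => metricAt a x' u v) (metricJet a x u v).toContinuousLinearMap x :=
  hasFDerivAt_metricAt (fun i j => differentiableAt_of_smoothOn hU (ha.smooth i j) hx) u v

lemma metricJet_comm (hU : IsOpen U) (ha : IsRiemannianMetricOn U a) (hx : x ∈ U)
    (u v w : Fin n → ℝ) : metricJet a x u v w = metricJet a x v u w := by
  have hcomm : (fun x' => metricAt a x' u v) =ᶠ[𝓝 x] fun x' => metricAt a x' v u := by
    filter_upwards [hU.mem_nhds hx] with x' hx'
    exact (metricAt_isSymm (ha.posDef x' hx')).eq u v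
  have := ((ha.hasFDerivAt hU hx v u).congr_of_eventuallyEq hcomm).unique
    (ha.hasFDerivAt hU hx u v)
  simpa using congr($this w).symm

lemma smoothOn_inv (ha : IsRiemannianMetricOn U a) (i j : Fin n) :
    ContDiffOn ℝ ∞ (fun x => (a x)⁻¹ i j) U := by
  have smoothOn_det {M : (Fin n → ℝ) → Matrix (Fin n) (Fin n) ℝ}
      (hM : ∀ i j, ContDiffOn ℝ ∞ (fun x => M x i j) U) :
      ContDiffOn ℝ ∞ (fun x => (M x).det) U := by
    simp only [Matrix.det_apply']
    exact .sum fun σ _ => contDiffOn_const.mul (contDiffOn_prod fun i _ => hM _ _)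
  simp only [Matrix.inv_def, Matrix.smul_apply, smul_eq_mul, Ring.inverse_eq_inv',
    Matrix.adjugate_apply]
  refine ((smoothOn_det ha.smooth).inv fun x hx => (ha.posDef x hx).det_pos.ne').mul
    (smoothOn_det fun k l => ?_)
  by_cases hk : k = j
  · simpa only [hk, Matrix.updateRow_self] using contDiffOn_const
  · simpa only [Matrix.updateRow_ne hk] using ha.smooth k l

lemma smoothOn_raise (ha : IsRiemannianMetricOn U a) (hb : IsOneFormOn U b) (i : Fin n) :
    ContDiffOn ℝ ∞ (fun x => raise a x (b x) i) U :=
  ContDiffOn.sum (s := Finset.univ) fun j _ => (ha.smoothOn_inv i j).mul (hb j)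

lemma smoothOn_normSq (ha : IsRiemannianMetricOn U a) (hb : IsOneFormOn U b) :
    ContDiffOn ℝ ∞ (normSq a b) U :=
  ContDiffOn.sum (s := Finset.univ) fun j _ => (hb j).mul (ha.smoothOn_raise hb j)

/-- `‖b‖²` is the maximum over `v` of `2 b(v) - a(v, v)`, attained at `v = b♯`; hence only the
explicit dependence on the point contributes to its derivative. -/
lemma hasFDerivAt_normSq (hU : IsOpen U) (ha : IsRiemannianMetricOn U a) (hb : IsOneFormOn U b)
    (hx : x ∈ U) :
    HasFDerivAt (normSq a b)
      ((2 : ℝ) • formJet b x (raise a x (b x))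
        - metricJet a x (raise a x (b x)) (raise a x (b x))).toContinuousLinearMap x := by
  set e := raise a x (b x)
  have htouch :
      IsLocalMin (fun x' => normSq a b x' - (2 * formAt b x' e - metricAt a x' e e)) x := by
    filter_upwards [hU.mem_nhds hx] with x' hx'
    have hat : normSq a b x = 2 * formAt b x e - metricAt a x e e := by
      rw [metricAt_raise_self (ha.posDef x hx), normSq_eq_formAt]
      ring
    have := two_mul_formAt_sub_metricAt_le (b := b) (ha.posDef x' hx') e
    linarith
  have hnorm := (differentiableAt_of_smoothOn hU (ha.smoothOn_normSq hb) hx).hasFDerivAt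
  have hlower := ((hb.hasFDerivAt hU hx e).const_mul 2).fun_sub (ha.hasFDerivAt hU hx e e)
  refine hnorm.congr_fderiv ?_
  rw [sub_eq_zero.1 (htouch.hasFDerivAt_eq_zero (hnorm.fun_sub hlower))]
  rfl

end IsRiemannianMetricOn

end FirstJets

section Calculus

variable {E : Type*} [NormedAddCommGroup E] [NormedSpace ℝ E]

lemma hasFDerivAt_bilin_self [FiniteDimensional ℝ E] (G : BilinForm ℝ E) (y : E) :
    HasFDerivAt (fun y => G y y) (G y + G.flip y).toContinuousLinearMap y := by
  refine ((G.toContinuousBilinearMap.hasFDerivAt (x := y)).clm_apply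
    (hasFDerivAt_id y)).congr_fderiv ?_
  ext v
  simp

variable {χ : ℝ → ℝ} {χ' : ℝ} {A B : E → ℝ} {A' B' : E →L[ℝ] ℝ} {x : E}

lemma hasFDerivAt_comp_ratio (hA : HasFDerivAt A A' x) (hB : HasFDerivAt B B' x) (hpos : 0 < A x)
    (hχ : HasDerivAt χ χ' (B x / √(A x))) :
    HasFDerivAt (fun x => χ (B x / √(A x)))
      ((χ' / √(A x)) • B' - (χ' * (B x / √(A x)) / (2 * A x)) • A') x := by
  have hr : 0 < √(A x) := Real.sqrt_pos.2 hpos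
  have hinv := (hasDerivAt_inv hr.ne').comp_hasFDerivAt x (hA.sqrt hpos.ne')
  refine (hχ.comp_hasFDerivAt x (hB.fun_mul hinv)).congr_fderiv ?_
  ext v
  have hsq : A x = √(A x) ^ 2 := (Real.sq_sqrt hpos.le).symm
  rw [hsq, Real.sqrt_sq hr.le]
  simp only [smul_apply, add_apply, sub_apply, smul_eq_mul, Function.comp_apply]
  field_simp
  ring

lemma hasFDerivAt_sqrt_mul_comp_ratio (hA : HasFDerivAt A A' x) (hB : HasFDerivAt B B' x)
    (hpos : 0 < A x) (hχ : HasDerivAt χ χ' (B x / √(A x))) :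
    HasFDerivAt (fun x => √(A x) * χ (B x / √(A x)))
      (χ' • B' + ((χ (B x / √(A x)) - B x / √(A x) * χ') / (2 * √(A x))) • A') x := by
  have hr : 0 < √(A x) := Real.sqrt_pos.2 hpos
  refine ((hA.sqrt hpos.ne').fun_mul
    (hasFDerivAt_comp_ratio hA hB hpos hχ)).congr_fderiv ?_
  ext v
  have hsq : A x = √(A x) ^ 2 := (Real.sq_sqrt hpos.le).symm
  rw [hsq, Real.sqrt_sq hr.le]
  simp only [smul_apply, add_apply, sub_apply, smul_eq_mul]
  field_simp
  ring

lemma hasFDerivAt_sq_sqrt_mul_comp_ratio (hA : HasFDerivAt A A' x) (hB : HasFDerivAt B B' x)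
    (hpos : 0 < A x) (hχ : HasDerivAt χ χ' (B x / √(A x))) :
    HasFDerivAt (fun x => (√(A x) * χ (B x / √(A x))) ^ 2)
      ((χ (B x / √(A x)) * (χ (B x / √(A x)) - B x / √(A x) * χ')) • A'
        + (√(A x) * (2 * χ (B x / √(A x)) * χ')) • B') x := by
  have : 0 < √(A x) := Real.sqrt_pos.2 hpos
  refine ((hasFDerivAt_sqrt_mul_comp_ratio hA hB hpos hχ).pow 2).congr_fderiv ?_
  ext v
  simp only [smul_apply, add_apply, smul_eq_mul, nsmul_eq_mul, Nat.cast_ofNat,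
    Nat.add_one_sub_one, pow_one]
  field_simp
  ring

end Calculus

section Coefficients

/-- The coefficient `ρ = φ(φ - sφ')` of `a_ij` in the fundamental tensor of `α φ(β/α)`. -/
def rho (φ : ℝ → ℝ) (s : ℝ) : ℝ := φ s * (φ s - s * deriv φ s)

/-- The coefficient `ρ₀ = φφ'' + φ'²` of `b_i b_j` in the fundamental tensor of `α φ(β/α)`. -/
def rho₀ (φ : ℝ → ℝ) (s : ℝ) : ℝ := φ s * deriv (deriv φ) s + deriv φ s ^ 2

/-- The coefficient `ρ₁ = φφ' - s(φφ'' + φ'²)` of the mixed terms in the fundamental tensor of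
`α φ(β/α)`. -/
def rho₁ (φ : ℝ → ℝ) (s : ℝ) : ℝ := φ s * deriv φ s - s * rho₀ φ s

variable {k₁ k₂ k₃ : ℝ} {I : Set ℝ} {φ : ℝ → ℝ} {s : ℝ}

lemma SolvesODE.rho₀_eq (hode : SolvesODE k₁ k₂ k₃ I φ) (hs : s ∈ I) :
    rho₀ φ s = s * (k₂ - k₃ * s ^ 2) * rho₁ φ s + k₁ * rho φ s := by
  simp only [rho, rho₁, rho₀]
  linear_combination -hode s hs

lemma hasDerivAt_rho (hφ : HasDerivAt φ (deriv φ s) s)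
    (hφ' : HasDerivAt (deriv φ) (deriv (deriv φ) s) s) : HasDerivAt (rho φ) (rho₁ φ s) s := by
  refine (hφ.fun_mul (hφ.fun_sub ((hasDerivAt_id s).fun_mul hφ'))).congr_deriv ?_
  simp only [rho₁, rho₀, id]
  ring

lemma hasDerivAt_two_mul_mul_deriv (hφ : HasDerivAt φ (deriv φ s) s)
    (hφ' : HasDerivAt (deriv φ) (deriv (deriv φ) s) s) :
    HasDerivAt (fun s => 2 * φ s * deriv φ s) (2 * rho₀ φ s) s := by
  refine ((hφ.const_mul 2).fun_mul hφ').congr_deriv ?_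
  rw [rho₀]
  ring

end Coefficients

section FlatnessTensor

variable {V : Type*} [AddCommGroup V] [Module ℝ V]

/-- The derivative with respect to the base point of `α² φ(β/α)²` at the vector `y`, in terms of the
first jets `S` and `T` of `β` and `α²` (as in `evenPart`). -/
def baseDeriv (φ : ℝ → ℝ) (G : BilinForm ℝ V) (β : V →ₗ[ℝ] ℝ) (S : BilinForm ℝ V)
    (T : V →ₗ[ℝ] BilinForm ℝ V) (y : V) : V →ₗ[ℝ] ℝ :=
  rho φ (β y / √(G y y)) • T y y
    + (√(G y y) * (2 * φ (β y / √(G y y)) * deriv φ (β y / √(G y y)))) • S y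

/-- The derivative of `baseDeriv` with respect to `y`, the first argument being its direction. -/
def mixedDeriv (φ : ℝ → ℝ) (G : BilinForm ℝ V) (β : V →ₗ[ℝ] ℝ) (S : BilinForm ℝ V)
    (T : V →ₗ[ℝ] BilinForm ℝ V) (y : V) : BilinForm ℝ V :=
  let s := β y / √(G y y)
  (rho₁ φ s • ((1 / √(G y y)) • β - (s / G y y) • G y)).smulRight (T y y)
    + (2 * rho φ s) • T.flip y
    + ((2 * rho₁ φ s / √(G y y)) • G y + (2 * rho₀ φ s) • β).smulRight (S y)
    + (√(G y y) * (2 * φ s * deriv φ s)) • S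

/-- The left hand side `[F²]_{xᵏyˡ} yᵏ - 2 [F²]_{xˡ}` of the equation of dual flatness for
`F = α φ(β/α)`, as a covector in the index `l`. -/
def flatExpr (φ : ℝ → ℝ) (G : BilinForm ℝ V) (β : V →ₗ[ℝ] ℝ) (S : BilinForm ℝ V)
    (T : V →ₗ[ℝ] BilinForm ℝ V) (y : V) : V →ₗ[ℝ] ℝ :=
  LinearMap.flip (mixedDeriv φ G β S T y) y - (2 : ℝ) • baseDeriv φ G β S T y

variable {k₁ k₂ k₃ : ℝ} {I : Set ℝ} {φ : ℝ → ℝ} {G : BilinForm ℝ V} {β : V →ₗ[ℝ] ℝ}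
  {S : BilinForm ℝ V} {T : V →ₗ[ℝ] BilinForm ℝ V} {y : V}

lemma flatExpr_eq_rho_add_rho₁ (hode : SolvesODE k₁ k₂ k₃ I φ) (hpos : 0 < G y y)
    (hs : β y / √(G y y) ∈ I) (v : V) :
    flatExpr φ G β S T y v
      = rho φ (β y / √(G y y)) * evenPart k₁ β S T v y
        + rho₁ φ (β y / √(G y y)) / (G y y * √(G y y)) * oddPart k₂ k₃ G β S T v y := by
  have hrho₀ := hode.rho₀_eq hs
  have hr : 0 < √(G y y) := Real.sqrt_pos.2 hpos
  have hβ : β y = β y / √(G y y) * √(G y y) := by field_simp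
  have hG : G y y = √(G y y) ^ 2 := (Real.sq_sqrt hpos.le).symm
  have hφφ' : φ (β y / √(G y y)) * deriv φ (β y / √(G y y))
      = rho₁ φ (β y / √(G y y)) + β y / √(G y y) * rho₀ φ (β y / √(G y y)) := by
    rw [rho₁]
    ring
  simp only [flatExpr, mixedDeriv, baseDeriv, evenPart, oddPart, LinearMap.sub_apply,
    LinearMap.add_apply, LinearMap.smul_apply, LinearMap.smulRight_apply, LinearMap.flip_apply,
    smul_eq_mul, mul_assoc 2 (φ _) (deriv φ _), hφφ', hrho₀]
  generalize rho φ (β y / √(G y y)) = u, rho₁ φ (β y / √(G y y)) = p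
  generalize β y / √(G y y) = s at hβ ⊢
  generalize √(G y y) = r at hβ hG hr ⊢
  rw [hβ, hG]
  field_simp
  ring

end FlatnessTensor

section DuallyFlat

variable {n : ℕ} {U : Set (Fin n → ℝ)} {a : (Fin n → ℝ) → Matrix (Fin n) (Fin n) ℝ}
  {b : (Fin n → ℝ) → Fin n → ℝ} {x y : Fin n → ℝ} {I : Set ℝ} {φ : ℝ → ℝ}

lemma alphaBetaFun_eq : alphaBetaFun φ a b x y
    = √(metricAt a x y y) * φ (formAt b x y / √(metricAt a x y y)) := by
  rw [alphaBetaFun, alpha_eq_sqrt, beta_eq_formAt]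

lemma hasFDerivAt_alphaBetaFun_sq (hU : IsOpen U) (ha : IsRiemannianMetricOn U a)
    (hb : IsOneFormOn U b) (hx : x ∈ U) (hy : y ≠ 0)
    (hφ : DifferentiableAt ℝ φ (formAt b x y / √(metricAt a x y y))) :
    HasFDerivAt (fun x' => alphaBetaFun φ a b x' y ^ 2)
      (baseDeriv φ (metricAt a x) (formAt b x) (formJet b x) (metricJet a x)
        y).toContinuousLinearMap x := by
  simp only [alphaBetaFun_eq]
  exact hasFDerivAt_sq_sqrt_mul_comp_ratio (ha.hasFDerivAt hU hx y y) (hb.hasFDerivAt hU hx y)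
    (metricAt_pos (ha.posDef x hx) y hy) hφ.hasDerivAt

lemma hasFDerivAt_baseDeriv {G : BilinForm ℝ (Fin n → ℝ)} {β : (Fin n → ℝ) →ₗ[ℝ] ℝ}
    {S : BilinForm ℝ (Fin n → ℝ)} {T : (Fin n → ℝ) →ₗ[ℝ] BilinForm ℝ (Fin n → ℝ)}
    (hGs : G.IsSymm) (hTs : ∀ u v w, T u v w = T v u w) (hpos : 0 < G y y)
    (hφ : HasDerivAt φ (deriv φ (β y / √(G y y))) (β y / √(G y y)))
    (hφ' : HasDerivAt (deriv φ) (deriv (deriv φ) (β y / √(G y y))) (β y / √(G y y)))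
    (w : Fin n → ℝ) :
    HasFDerivAt (fun y => baseDeriv φ G β S T y w)
      ((mixedDeriv φ G β S T y).flip w).toContinuousLinearMap y := by
  have hG := hasFDerivAt_bilin_self G y
  have hβ : HasFDerivAt β β.toContinuousLinearMap y := β.toContinuousLinearMap.hasFDerivAt
  have hT := hasFDerivAt_bilin_self (T.compr₂ (LinearMap.applyₗ w)) y
  have hS : HasFDerivAt (S.flip w) (S.flip w).toContinuousLinearMap y :=
    (S.flip w).toContinuousLinearMap.hasFDerivAt
  refine (((hasFDerivAt_comp_ratio hG hβ hpos (hasDerivAt_rho hφ hφ')).fun_mul hT).fun_add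
    ((hasFDerivAt_sqrt_mul_comp_ratio hG hβ hpos
      (hasDerivAt_two_mul_mul_deriv hφ hφ')).fun_mul hS)).congr_fderiv ?_
  ext v
  have : 0 < √(G y y) := Real.sqrt_pos.2 hpos
  simp only [mixedDeriv, add_apply, sub_apply, smul_apply, LinearMap.coe_toContinuousLinearMap',
    BilinForm.flip_apply, LinearMap.compr₂_apply, LinearMap.applyₗ_apply_apply,
    LinearMap.add_apply, LinearMap.sub_apply, LinearMap.smul_apply, LinearMap.smulRight_apply,
    LinearMap.flip_apply, smul_eq_mul, hGs.eq v y, hTs y v w]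
  rw [rho₁]
  field_simp
  ring

lemma duallyFlat_eq_flatExpr (hU : IsOpen U) (ha : IsRiemannianMetricOn U a)
    (hb : IsOneFormOn U b) (hI : IsOpen I) (hφ : ContDiffOn ℝ ∞ φ I) (hx : x ∈ U)
    (hdom : ∀ y, y ≠ 0 → formAt b x y / √(metricAt a x y y) ∈ I) (hy : y ≠ 0) (l : Fin n) :
    ∑ k, pd l (fun y' => pd k (fun x' => alphaBetaFun φ a b x' y' ^ 2) x) y * y k
        - 2 * pd l (fun x' => alphaBetaFun φ a b x' y ^ 2) x
      = flatExpr φ (metricAt a x) (formAt b x) (formJet b x) (metricJet a x) y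
          (Pi.single l 1) := by
  have hpd (y : Fin n → ℝ) (hy : y ≠ 0) (k : Fin n) :
      pd k (fun x' => alphaBetaFun φ a b x' y ^ 2) x
        = baseDeriv φ (metricAt a x) (formAt b x) (formJet b x) (metricJet a x) y
            (Pi.single k 1) :=
    pd_eq_of_hasFDerivAt (hasFDerivAt_alphaBetaFun_sq hU ha hb hx hy
      (differentiableAt_of_smoothOn hI hφ (hdom y hy))) k
  have hpdpd (k : Fin n) :
      pd l (fun y' => pd k (fun x' => alphaBetaFun φ a b x' y' ^ 2) x) y
        = mixedDeriv φ (metricAt a x) (formAt b x) (formJet b x) (metricJet a x) y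
            (Pi.single l 1) (Pi.single k 1) := by
    rw [pd_congr (g := fun y' => baseDeriv φ (metricAt a x) (formAt b x) (formJet b x)
      (metricJet a x) y' (Pi.single k 1))]
    · have hφ' : ContDiffOn ℝ ∞ (deriv φ) I := hφ.deriv_of_isOpen hI (by simp)
      exact pd_eq_of_hasFDerivAt (hasFDerivAt_baseDeriv (metricAt_isSymm (ha.posDef x hx))
        (ha.metricJet_comm hU hx) (metricAt_pos (ha.posDef x hx) y hy)
        (differentiableAt_of_smoothOn hI hφ (hdom y hy)).hasDerivAt
        (differentiableAt_of_smoothOn hI hφ' (hdom y hy)).hasDerivAt (Pi.single k 1)) l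
    · filter_upwards [isOpen_ne.mem_nhds hy] with y' hy'
      exact hpd y' hy' k
  simp only [hpdpd, hpd y hy, sum_apply_single_mul]
  rfl

end DuallyFlat

section PointwiseFlat

variable {n : ℕ} {U : Set (Fin n → ℝ)} {a : (Fin n → ℝ) → Matrix (Fin n) (Fin n) ℝ}
  {b : (Fin n → ℝ) → Fin n → ℝ} {x : Fin n → ℝ} {k₁ k₂ k₃ : ℝ} {I : Set ℝ} {φ : ℝ → ℝ}

lemma exists_ne_zero_of_apply_eq_zero (hn : 2 ≤ n) (β : (Fin n → ℝ) →ₗ[ℝ] ℝ) :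
    ∃ u, u ≠ 0 ∧ β u = 0 := by
  have hker : LinearMap.ker β ≠ ⊥ := LinearMap.ker_ne_bot_of_finrank_lt (by
    rwa [Module.finrank_self, Module.finrank_fin_fun])
  obtain ⟨u, hu, hu0⟩ := Submodule.exists_mem_ne_zero_of_ne_bot hker
  exact ⟨u, hu0, hu⟩

lemma rho_zero : rho φ 0 = φ 0 ^ 2 := by rw [rho]; ring

lemma rho₁_zero : rho₁ φ 0 = φ 0 * deriv φ 0 := by rw [rho₁]; ring

lemma continuousAt_rho_and_rho₁ (hI : IsOpen I) (hφ : ContDiffOn ℝ ∞ φ I) {s : ℝ} (hs : s ∈ I) :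
    ContinuousAt (rho φ) s ∧ ContinuousAt (rho₁ φ) s := by
  have hφ' : ContDiffOn ℝ ∞ (deriv φ) I := hφ.deriv_of_isOpen hI (by simp)
  have hφ'' : ContDiffOn ℝ ∞ (deriv (deriv φ)) I := hφ'.deriv_of_isOpen hI (by simp)
  have h₀ : ContinuousAt φ s := (differentiableAt_of_smoothOn hI hφ hs).continuousAt
  have h₁ : ContinuousAt (deriv φ) s := (differentiableAt_of_smoothOn hI hφ' hs).continuousAt
  have h₂ : ContinuousAt (deriv (deriv φ)) s :=
    (differentiableAt_of_smoothOn hI hφ'' hs).continuousAt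
  unfold rho rho₁ rho₀
  exact ⟨by fun_prop, by fun_prop⟩

/-- `a` and `b` have the first jets at `x` of the data of a dually flat metric `α φ(β/α)`. -/
abbrev IsFlatJetAt (k₁ k₂ k₃ : ℝ) (a : (Fin n → ℝ) → Matrix (Fin n) (Fin n) ℝ)
    (b : (Fin n → ℝ) → Fin n → ℝ) (x : Fin n → ℝ) (θ : (Fin n → ℝ) →ₗ[ℝ] ℝ) (m : ℝ) : Prop :=
  IsFlatJet k₁ k₂ k₃ (metricAt a x) (formAt b x) (formJet b x) (metricJet a x) θ m

lemma exists_isFlatJetAt (hn : 2 ≤ n) (hU : IsOpen U) (ha : IsRiemannianMetricOn U a)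
    (hb : IsOneFormOn U b) (hI : IsSymmetricOpenInterval I) (hφ : ContDiffOn ℝ ∞ φ I)
    (hφpos : ∀ s ∈ I, 0 < φ s) (hφ0 : deriv φ 0 ≠ 0) (hode : SolvesODE k₁ k₂ k₃ I φ)
    (hdom : ∀ x ∈ U, ∀ y, y ≠ 0 → beta b x y / alpha a x y ∈ I)
    (hflat : IsDuallyFlatOn U (alphaBetaFun φ a b)) (hx : x ∈ U) (hbx : b x ≠ 0)
    (hQ : 0 < deformQ k₂ k₃ (normSq a b x)) :
    ∃ θ m, IsFlatJetAt k₁ k₂ k₃ a b x θ m := by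
  have hp := ha.posDef x hx
  have hdom (y : Fin n → ℝ) (hy : y ≠ 0) : formAt b x y / √(metricAt a x y y) ∈ I := by
    simpa only [beta_eq_formAt, alpha_eq_sqrt] using hdom x hx y hy
  have hφ00 : φ 0 ≠ 0 := (hφpos 0 hI.zero_mem).ne'
  obtain ⟨u₀, hu₀, hβu⟩ := exists_ne_zero_of_apply_eq_zero hn (formAt b x)
  obtain ⟨hrho, hrho₁⟩ := continuousAt_rho_and_rho₁ hI.isOpen hφ hI.zero_mem
  have hexpr (y : Fin n → ℝ) (hy : y ≠ 0) :
      flatExpr φ (metricAt a x) (formAt b x) (formJet b x) (metricJet a x) y = 0 := by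
    refine LinearMap.pi_ext' fun l => LinearMap.ext_ring ?_
    simpa [← duallyFlat_eq_flatExpr hU ha hb hI.isOpen hφ hx hdom hy] using hflat x hx y hy l
  have hparity := evenPart_eq_zero_and_oddPart_eq_zero (k₁ := k₁) (k₂ := k₂) (k₃ := k₃)
    (metricAt_pos hp) hu₀ hβu hrho hrho₁ (by simp [rho_zero, hφ00])
    (by simp [rho₁_zero, hφ00, hφ0]) fun v y hy => by
      rw [← flatExpr_eq_rho_add_rho₁ hode (metricAt_pos hp y hy) (hdom y hy), hexpr y hy,
        LinearMap.zero_apply]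
  exact exists_isFlatJet (metricAt_isSymm hp) (metricAt_pos hp) (ha.metricJet_comm hU hx) hu₀ hβu
    (metricAt_raise_left hp (b x)) (normSq_pos hp hbx) hQ (fun v y => (hparity v y).1)
    fun v y => (hparity v y).2

lemma isDuallyFlatOn_of_isFlatJetAt (hU : IsOpen U) (ha : IsRiemannianMetricOn U a)
    (hb : IsOneFormOn U b) (hI : IsOpen I) (hφ : ContDiffOn ℝ ∞ φ I)
    (hode : SolvesODE k₁ k₂ k₃ I φ)
    (hdom : ∀ x ∈ U, ∀ y, y ≠ 0 → beta b x y / alpha a x y ∈ I)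
    (hjet : ∀ x ∈ U, ∃ θ m, IsFlatJetAt k₁ k₂ k₃ a b x θ m) :
    IsDuallyFlatOn U (alphaBetaFun φ a b) := by
  intro x hx y hy l
  have hp := ha.posDef x hx
  have hdom (y : Fin n → ℝ) (hy : y ≠ 0) : formAt b x y / √(metricAt a x y y) ∈ I := by
    simpa only [beta_eq_formAt, alpha_eq_sqrt] using hdom x hx y hy
  obtain ⟨θ, m, h⟩ := hjet x hx
  rw [duallyFlat_eq_flatExpr hU ha hb hI hφ hx hdom hy,
    flatExpr_eq_rho_add_rho₁ hode (metricAt_pos hp y hy) (hdom y hy),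
    h.evenPart_eq_zero (metricAt_isSymm hp), h.oddPart_eq_zero (metricAt_isSymm hp), mul_zero,
    mul_zero, add_zero]

end PointwiseFlat

section Spray

variable {n : ℕ} {U : Set (Fin n → ℝ)} {a : (Fin n → ℝ) → Matrix (Fin n) (Fin n) ℝ}
  {b θ : (Fin n → ℝ) → Fin n → ℝ} {x : Fin n → ℝ}

/-- Twice the Christoffel symbols of the first kind, as a trilinear form whose last argument is the
lowered index. -/
def lowerChristoffel (a : (Fin n → ℝ) → Matrix (Fin n) (Fin n) ℝ) (x : Fin n → ℝ) :
    (Fin n → ℝ) →ₗ[ℝ] BilinForm ℝ (Fin n → ℝ) :=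
  let T : (Fin n → ℝ) →ₗ[ℝ] BilinForm ℝ (Fin n → ℝ) :=
    LinearMap.lflip.toLinearMap ∘ₗ (metricJet a x).flip
  T + T.flip + (-1 : ℝ) • metricJet a x

lemma lowerChristoffel_apply (u v z : Fin n → ℝ) : lowerChristoffel a x u v z
    = metricJet a x z u v + metricJet a x z v u - metricJet a x u v z := by
  simp [lowerChristoffel, sub_eq_add_neg]

lemma christoffel_eq (i j k : Fin n) : christoffel a x i j k
    = 1 / 2 * lowerChristoffel a x (Pi.single j 1) (Pi.single k 1) ((a x)⁻¹ i) := by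
  rw [christoffel, ← sum_apply_single_mul]
  congr 1
  refine Finset.sum_congr rfl fun m _ => ?_
  simp only [lowerChristoffel_apply, metricJet_single]
  ring

lemma inv_apply_eq_raise (ℓ : (Fin n → ℝ) →ₗ[ℝ] ℝ) (i : Fin n) :
    ℓ ((a x)⁻¹ i) = raise a x (fun m => ℓ (Pi.single m 1)) i := by
  rw [← sum_apply_single_mul, raise, Matrix.mulVec, dotProduct_comm]
  rfl

lemma dotProductBilin_single (ℓ : (Fin n → ℝ) →ₗ[ℝ] ℝ) :
    dotProductBilin ℝ ℝ (fun m => ℓ (Pi.single m 1)) = ℓ :=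
  LinearMap.ext fun v => sum_apply_single_mul ℓ v

lemma metricAt_spray (h : (a x).PosDef) (y z : Fin n → ℝ) :
    metricAt a x z (spray a x y) = 1 / 4 * lowerChristoffel a x y y z := by
  have hspray : spray a x y
      = (1 / 4 : ℝ) • raise a x fun m => lowerChristoffel a x y y (Pi.single m 1) := by
    ext i
    rw [Pi.smul_apply, ← inv_apply_eq_raise, smul_eq_mul, spray]
    simp only [christoffel_eq]
    have hinner (j : Fin n) := sum_apply_single_mul
      ((lowerChristoffel a x (Pi.single j 1)).flip ((a x)⁻¹ i)) y
    have houter := sum_apply_single_mul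
      (((lowerChristoffel a x).flip y).flip ((a x)⁻¹ i)) y
    simp only [LinearMap.flip_apply, BilinForm.flip_apply] at hinner houter
    have hrow (j : Fin n) : ∑ k, 1 / 2 * lowerChristoffel a x (Pi.single j 1) (Pi.single k 1)
        ((a x)⁻¹ i) * y j * y k
        = 1 / 2 * (lowerChristoffel a x (Pi.single j 1) y ((a x)⁻¹ i) * y j) := by
      rw [← hinner, Finset.sum_mul, Finset.mul_sum]
      exact Finset.sum_congr rfl fun k _ => by ring
    rw [Finset.sum_congr rfl fun j _ => hrow j, ← Finset.mul_sum, houter]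
    ring
  rw [hspray, map_smul, metricAt_raise h, dotProductBilin_single, smul_eq_mul]

lemma covDeriv_eq (h : (a x).PosDef) (i j : Fin n) :
    covDeriv a b x i j = formJet b x (Pi.single i 1) (Pi.single j 1)
      - 1 / 2 * lowerChristoffel a x (Pi.single i 1) (Pi.single j 1) (raise a x (b x)) := by
  set ℓ := lowerChristoffel a x (Pi.single i 1) (Pi.single j 1)
  have hcontract : formAt b x (raise a x fun m => ℓ (Pi.single m 1)) = ℓ (raise a x (b x)) := by
    rw [← metricAt_raise_left h, metricAt_raise h, dotProductBilin_single]
  rw [covDeriv, formJet_single, ← hcontract, ← sum_apply_single_mul, Finset.mul_sum]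
  congr 1
  refine Finset.sum_congr rfl fun k _ => ?_
  rw [christoffel_eq, inv_apply_eq_raise]
  simp
  ring

end Spray

section DualRelation

variable {n : ℕ} {U : Set (Fin n → ℝ)} {a : (Fin n → ℝ) → Matrix (Fin n) (Fin n) ℝ}
  {b θ : (Fin n → ℝ) → Fin n → ℝ} {x : Fin n → ℝ}

lemma eq_symm_iff_of_quadratic {V : Type*} [AddCommGroup V] [Module ℝ V] {G : BilinForm ℝ V}
    {T : V →ₗ[ℝ] BilinForm ℝ V} (hGs : G.IsSymm) (hTs : ∀ u v w, T u v w = T v u w)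
    (θ : V →ₗ[ℝ] ℝ) :
    (∀ y z, 2 * T z y y - T y y z = 4 * (2 * θ y * G z y + θ z * G y y)) ↔
      ∀ u v w, T u v w = 4 * (θ u * G v w + θ v * G u w + θ w * G u v) := by
  refine ⟨fun h => ?_, fun h y z => ?_⟩
  · have hpolar (u v z : V) : T z u v + T z v u - T u v z
        = 4 * (θ u * G v z + θ v * G u z + θ z * G u v) := by
      have huv := h (u + v) z
      simp only [map_add, LinearMap.add_apply, hTs v u z, hGs.eq v u, hGs.eq z] at huv
      have hu := h u z
      have hv := h v z
      rw [hGs.eq z] at hu hv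
      linear_combination (huv - hu - hv) / 2
    intro u v w
    linear_combination (hpolar v w u + hpolar u w v - hTs v u w
      + 4 * θ u * hGs.eq w v + 4 * θ v * hGs.eq w u + 4 * θ w * hGs.eq v u) / 2
  · rw [h, h, hGs.eq y z]
    ring

/-- The first jets at `x` of a dually flat metric `a` and of a `1`-form `b` dually related to it;
the number `m` is the scalar `c` of the dual relation, increased by `2 θ(b♯)`. -/
structure IsDualJetAt (a : (Fin n → ℝ) → Matrix (Fin n) (Fin n) ℝ) (b : (Fin n → ℝ) → Fin n → ℝ)
    (x : Fin n → ℝ) (θ : (Fin n → ℝ) →ₗ[ℝ] ℝ) (m : ℝ) : Prop where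
  metric : ∀ u v w, metricJet a x u v w
    = 4 * (θ u * metricAt a x v w + θ v * metricAt a x u w + θ w * metricAt a x u v)
  form : ∀ u v, formJet b x u v
    = 4 * θ u * formAt b x v + 2 * θ v * formAt b x u + m * metricAt a x u v

lemma spray_eq_iff (hU : IsOpen U) (ha : IsRiemannianMetricOn U a) (hx : x ∈ U) :
    (∀ y i, spray a x y i = 2 * beta θ x y * y i + alpha a x y ^ 2 * raise a x (θ x) i) ↔
    ∀ u v w, metricJet a x u v w = 4 * (formAt θ x u * metricAt a x v w
      + formAt θ x v * metricAt a x u w + formAt θ x w * metricAt a x u v) := by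
  have hp := ha.posDef x hx
  rw [← eq_symm_iff_of_quadratic (metricAt_isSymm hp) (ha.metricJet_comm hU hx)]
  refine forall_congr' fun y => ?_
  set p := (2 * formAt θ x y) • y + (alpha a x y ^ 2) • raise a x (θ x)
  have hlower (z : Fin n → ℝ) : metricAt a x z p
      = 2 * formAt θ x y * metricAt a x z y + metricAt a x y y * formAt θ x z := by
    rw [map_add, map_smul, map_smul, metricAt_raise hp, alpha_sq hp, smul_eq_mul, smul_eq_mul]
  calc (∀ i, spray a x y i = 2 * beta θ x y * y i + alpha a x y ^ 2 * raise a x (θ x) i)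
      ↔ spray a x y = p := funext_iff.symm
    _ ↔ ∀ z, metricAt a x z (spray a x y) = metricAt a x z p :=
        ⟨fun h z => by rw [h], eq_of_metricAt_eq hp⟩
    _ ↔ _ := forall_congr' fun z => by
        rw [metricAt_spray hp, hlower, lowerChristoffel_apply]
        constructor <;> intro h <;> linarith

lemma covDeriv_eq_iff (ha : IsRiemannianMetricOn U a) (hx : x ∈ U) {c : ℝ}
    (h : ∀ u v w, metricJet a x u v w = 4 * (formAt θ x u * metricAt a x v w
      + formAt θ x v * metricAt a x u w + formAt θ x w * metricAt a x u v)) :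
    (∀ i j, covDeriv a b x i j = 2 * θ x i * b x j + c * a x i j) ↔
    ∀ u v, formJet b x u v = 4 * formAt θ x u * formAt b x v + 2 * formAt θ x v * formAt b x u
      + (c + 2 * formAt θ x (raise a x (b x))) * metricAt a x u v := by
  have hp := ha.posDef x hx
  set e := raise a x (b x)
  set B : BilinForm ℝ (Fin n → ℝ) := (4 : ℝ) • (formAt θ x).smulRight (formAt b x)
    + (2 : ℝ) • (formAt b x).smulRight (formAt θ x)
    + (c + 2 * formAt θ x e) • metricAt a x with hB
  have hBapply (u v : Fin n → ℝ) : B u v = 4 * formAt θ x u * formAt b x v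
      + 2 * formAt θ x v * formAt b x u + (c + 2 * formAt θ x e) * metricAt a x u v := by
    simp only [hB, LinearMap.add_apply, LinearMap.smul_apply, LinearMap.smulRight_apply,
      smul_eq_mul]
    ring
  have hentry (i j : Fin n) : covDeriv a b x i j = 2 * θ x i * b x j + c * a x i j ↔
      formJet b x (Pi.single i 1) (Pi.single j 1) = B (Pi.single i 1) (Pi.single j 1) := by
    rw [covDeriv_eq hp, lowerChristoffel_apply, h, h, h, hBapply]
    simp only [e, metricAt_raise hp, metricAt_raise_left hp, dotProductBilin_apply_apply,
      dotProduct_single_one, Matrix.toBilin'_single, (metricAt_isSymm hp).eq]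
    constructor <;> intro h <;> linarith
  simp only [hentry, ← hBapply]
  refine ⟨fun h u v => ?_, fun h i j => h _ _⟩
  have hext : formJet b x = B :=
    LinearMap.BilinForm.ext_basis (Pi.basisFun ℝ (Fin n)) fun i j => by simpa using h i j
  rw [hext]

lemma isDuallyRelatedOn_iff (hU : IsOpen U) (ha : IsRiemannianMetricOn U a)
    (hb : IsOneFormOn U b) :
    IsDuallyRelatedOn U a b ↔ ∃ (θ : (Fin n → ℝ) → Fin n → ℝ) (m : (Fin n → ℝ) → ℝ),
      IsOneFormOn U θ ∧ ContDiffOn ℝ ∞ m U ∧ ∀ x ∈ U, IsDualJetAt a b x (formAt θ x) (m x) := by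
  have hsmooth {θ : (Fin n → ℝ) → Fin n → ℝ} (hθ : IsOneFormOn U θ) :
      ContDiffOn ℝ ∞ (fun x => 2 * formAt θ x (raise a x (b x))) U :=
    contDiffOn_const.mul (.sum (s := Finset.univ) fun i _ => (hθ i).mul (ha.smoothOn_raise hb i))
  constructor
  · rintro ⟨θ, c, hθ, hc, hspray, hcov⟩
    refine ⟨θ, _, hθ, hc.add (hsmooth hθ), fun x hx => ?_⟩
    have hmetric := (spray_eq_iff hU ha hx).1 (hspray x hx)
    exact ⟨hmetric, (covDeriv_eq_iff ha hx hmetric).1 (hcov x hx)⟩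
  · rintro ⟨θ, m, hθ, hm, h⟩
    refine ⟨θ, _, hθ, hm.sub (hsmooth hθ), fun x hx => (spray_eq_iff hU ha hx).2 (h x hx).metric,
      fun x hx => (covDeriv_eq_iff ha hx (h x hx).metric).2 fun u v => ?_⟩
    rw [sub_add_cancel]
    exact (h x hx).form u v

lemma IsDualJetAt.hasFDerivAt_normSq (hU : IsOpen U) (ha : IsRiemannianMetricOn U a)
    (hb : IsOneFormOn U b) (hx : x ∈ U) {θ : (Fin n → ℝ) →ₗ[ℝ] ℝ} {m : ℝ}
    (h : IsDualJetAt a b x θ m) :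
    HasFDerivAt (normSq a b) ((2 * m) • (formAt b x).toContinuousLinearMap) x := by
  have hp := ha.posDef x hx
  refine (ha.hasFDerivAt_normSq hU hb hx).congr_fderiv ?_
  ext w
  simp only [LinearMap.coe_toContinuousLinearMap', LinearMap.sub_apply, LinearMap.smul_apply,
    h.form, h.metric, metricAt_raise_left hp, smul_apply, smul_eq_mul]
  ring

lemma IsDualJetAt.metricJet_right_comm {θ : (Fin n → ℝ) →ₗ[ℝ] ℝ} {m : ℝ} (hp : (a x).PosDef)
    (h : IsDualJetAt a b x θ m) (u v : Fin n → ℝ) :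
    metricJet a x u v v = metricJet a x v v u := by
  rw [h.metric, h.metric, (metricAt_isSymm hp).eq v u]
  ring

lemma isDuallyFlatOn_alpha (hU : IsOpen U) (ha : IsRiemannianMetricOn U a)
    (h : ∀ x ∈ U, ∀ u v, metricJet a x u v v = metricJet a x v v u) :
    IsDuallyFlatOn U (alpha a) := by
  have halpha : alpha a = alphaBetaFun (fun _ => 1) a 0 := by
    funext x y
    rw [alphaBetaFun, mul_one]
  intro x hx y hy l
  rw [halpha, duallyFlat_eq_flatExpr hU ha (b := 0) (fun _ => contDiffOn_const) isOpen_univ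
    contDiffOn_const hx (fun _ _ => Set.mem_univ _) hy l]
  simp [flatExpr, mixedDeriv, baseDeriv, rho, rho₁, rho₀, h x hx]

end DualRelation

section Deformation

variable {n : ℕ} {U : Set (Fin n → ℝ)} {a a' : (Fin n → ℝ) → Matrix (Fin n) (Fin n) ℝ}
  {b b' : (Fin n → ℝ) → Fin n → ℝ} {x : Fin n → ℝ} {k₁ k₂ k₃ m : ℝ} {f : ℝ → ℝ}

lemma IsFactorAt.hasFDerivAt_comp {E : Type*} [NormedAddCommGroup E] [NormedSpace ℝ E] {τ : E → ℝ}
    {ℓ : E →L[ℝ] ℝ} {x : E} (hf : IsFactorAt k₁ k₂ k₃ f (τ x)) (hQ : deformQ k₂ k₃ (τ x) ≠ 0)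
    (hτ : HasFDerivAt τ ((4 * m * deformQ k₂ k₃ (τ x)) • ℓ) x) :
    HasFDerivAt (fun x' => f (τ x')) ((f (τ x) * (m * (k₁ - k₂ + k₃ * τ x))) • ℓ) x := by
  refine (hf.hasDerivAt.comp_hasFDerivAt x hτ).congr_fderiv ?_
  rw [smul_smul]
  congr 1
  field_simp

lemma hasFDerivAt_sqrt_deformQ_comp {E : Type*} [NormedAddCommGroup E] [NormedSpace ℝ E]
    {τ : E → ℝ} {ℓ : E →L[ℝ] ℝ} {x : E} (hQ : 0 < deformQ k₂ k₃ (τ x))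
    (hτ : HasFDerivAt τ ((4 * m * deformQ k₂ k₃ (τ x)) • ℓ) x) :
    HasFDerivAt (fun x' => √(deformQ k₂ k₃ (τ x')))
      ((√(deformQ k₂ k₃ (τ x)) * (2 * m * (k₂ - 2 * k₃ * τ x))) • ℓ) x := by
  refine ((((hasLogDerivAt_deformQ hQ).hasDerivAt).sqrt hQ.ne').comp_hasFDerivAt x
    hτ).congr_fderiv ?_
  rw [smul_smul]
  congr 1
  have hsqrt := Real.sq_sqrt hQ.le
  have := Real.sqrt_pos.2 hQ
  generalize √(deformQ k₂ k₃ (τ x)) = r at *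
  rw [← hsqrt]
  field_simp
  ring

lemma IsFlatJetAt.hasFDerivAt_normSq (hU : IsOpen U) (ha : IsRiemannianMetricOn U a)
    (hb : IsOneFormOn U b) (hx : x ∈ U) {θ : (Fin n → ℝ) →ₗ[ℝ] ℝ}
    (h : IsFlatJetAt k₁ k₂ k₃ a b x θ m) :
    HasFDerivAt (normSq a b)
      ((4 * m * deformQ k₂ k₃ (normSq a b x)) • (formAt b x).toContinuousLinearMap) x := by
  refine (ha.hasFDerivAt_normSq hU hb hx).congr_fderiv (ContinuousLinearMap.ext fun w => ?_)
  have hp := ha.posDef x hx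
  simp only [LinearMap.coe_toContinuousLinearMap', LinearMap.sub_apply, LinearMap.smul_apply,
    smul_apply, smul_eq_mul, h.metric, h.form, metricAt_raise_left hp,
    ← normSq_eq_formAt, deformQ]
  ring

/-- The pair `(a', b')` is the deformation of `(a, b)` with factor `f`, `t` being the squared norm
of `b` with respect to `a`:
`f(t)² a' = a + (k₂ - k₃ t) b ⊗ b` and `f(t) b' = -√(1 + k₂ t - k₃ t²) b`. -/
structure IsDeformedOn (k₁ k₂ k₃ : ℝ) (f : ℝ → ℝ) (U : Set (Fin n → ℝ))
    (a : (Fin n → ℝ) → Matrix (Fin n) (Fin n) ℝ) (b : (Fin n → ℝ) → Fin n → ℝ)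
    (a' : (Fin n → ℝ) → Matrix (Fin n) (Fin n) ℝ) (b' : (Fin n → ℝ) → Fin n → ℝ) : Prop where
  isOpen : IsOpen U
  metric : IsRiemannianMetricOn U a
  form : IsOneFormOn U b
  metric' : IsRiemannianMetricOn U a'
  form' : IsOneFormOn U b'
  factor : ∀ x ∈ U, IsFactorAt k₁ k₂ k₃ f (normSq a b x)
  pos : ∀ x ∈ U, 0 < deformQ k₂ k₃ (normSq a b x)
  metric_eq : ∀ x ∈ U, ∀ u v, f (normSq a b x) ^ 2 * metricAt a' x u v
    = metricAt a x u v + (k₂ - k₃ * normSq a b x) * (formAt b x u * formAt b x v)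
  form_eq : ∀ x ∈ U, ∀ v, f (normSq a b x) * formAt b' x v
    = -(√(deformQ k₂ k₃ (normSq a b x)) * formAt b x v)

namespace IsDeformedOn

lemma normSq_eq (h : IsDeformedOn k₁ k₂ k₃ f U a b a' b') (hx : x ∈ U) :
    normSq a' b' x = normSq a b x := by
  have hf := (h.factor x hx).pos
  have hQ := h.pos x hx
  have ha := h.metric_eq x hx
  have hb := h.form_eq x hx
  have hκ : 1 + (k₂ - k₃ * normSq a b x) * normSq a b x = deformQ k₂ k₃ (normSq a b x) := by
    rw [deformQ]
    ring
  have hrank := normSq_rankOne (b' := b') (l := 1 / f (normSq a b x) ^ 2)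
    (μ := -(√(deformQ k₂ k₃ (normSq a b x)) / f (normSq a b x)))
    (h.metric.posDef x hx) (h.metric'.posDef x hx)
    (fun u v => by rw [← ha]; field_simp) (fun v => by field_simp; linear_combination hb v)
    (by positivity) (hκ.trans_ne hQ.ne')
  rw [hrank, hκ, neg_sq, div_pow, Real.sq_sqrt hQ.le]
  field_simp

lemma form_eq_zero_iff (h : IsDeformedOn k₁ k₂ k₃ f U a b a' b') (hx : x ∈ U) :
    b' x = 0 ↔ b x = 0 := by
  have hf := (h.factor x hx).pos
  have hr := Real.sqrt_pos.2 (h.pos x hx)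
  have hb := h.form_eq x hx
  refine ⟨fun h0 => dotProduct_eq_zero _ fun v => ?_, fun h0 => dotProduct_eq_zero _ fun v => ?_⟩
  · simpa [h0, hr.ne'] using hb v
  · simpa [h0, hf.ne'] using hb v

lemma formJet_eq (h : IsDeformedOn k₁ k₂ k₃ f U a b a' b') (hx : x ∈ U)
    (ht : HasFDerivAt (normSq a b)
      ((4 * m * deformQ k₂ k₃ (normSq a b x)) • (formAt b x).toContinuousLinearMap) x)
    (u w : Fin n → ℝ) : f (normSq a b x) * formJet b' x u w
      = -(√(deformQ k₂ k₃ (normSq a b x)) * (formJet b x u w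
        - m * (k₁ - 3 * k₂ + 5 * k₃ * normSq a b x) * (formAt b x u * formAt b x w))) := by
  have hU := h.isOpen
  have hleft := ((h.factor x hx).hasFDerivAt_comp (h.pos x hx).ne' ht).mul
    (h.form'.hasFDerivAt hU hx u)
  have hright := ((hasFDerivAt_sqrt_deformQ_comp (h.pos x hx) ht).mul
    (h.form.hasFDerivAt hU hx u)).neg
  have heq := hleft.unique (hright.congr_of_eventuallyEq
    (Filter.eventually_of_mem (hU.mem_nhds hx) fun x' hx' => h.form_eq x' hx' u))
  have := congr($heq w)
  simp only [add_apply, neg_apply,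
    smul_apply, LinearMap.coe_toContinuousLinearMap', smul_eq_mul] at this
  linear_combination this - m * (k₁ - k₂ + k₃ * normSq a b x) * formAt b x w * h.form_eq x hx u

lemma metricJet_eq (h : IsDeformedOn k₁ k₂ k₃ f U a b a' b') (hx : x ∈ U)
    (ht : HasFDerivAt (normSq a b)
      ((4 * m * deformQ k₂ k₃ (normSq a b x)) • (formAt b x).toContinuousLinearMap) x)
    (u v w : Fin n → ℝ) : f (normSq a b x) ^ 2 * metricJet a' x u v w
      = metricJet a x u v w + (k₂ - k₃ * normSq a b x)
          * (formAt b x u * formJet b x v w + formAt b x v * formJet b x u w)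
        - 4 * m * k₃ * deformQ k₂ k₃ (normSq a b x) * (formAt b x u * formAt b x v * formAt b x w)
        - 2 * m * (k₁ - k₂ + k₃ * normSq a b x) * formAt b x w * (metricAt a x u v
          + (k₂ - k₃ * normSq a b x) * (formAt b x u * formAt b x v)) := by
  have hU := h.isOpen
  have hleft := (((h.factor x hx).hasFDerivAt_comp (h.pos x hx).ne' ht).pow 2).mul
    (h.metric'.hasFDerivAt hU hx u v)
  have hright := (h.metric.hasFDerivAt hU hx u v).add (((ht.const_mul k₃).const_sub k₂).mul
    ((h.form.hasFDerivAt hU hx u).mul (h.form.hasFDerivAt hU hx v)))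
  have heq := hleft.unique (hright.congr_of_eventuallyEq
    (Filter.eventually_of_mem (hU.mem_nhds hx) fun x' hx' => h.metric_eq x' hx' u v))
  have := congr($heq w)
  simp only [add_apply, neg_apply, Pi.mul_apply, smul_apply, smul_eq_mul, nsmul_eq_mul,
    LinearMap.coe_toContinuousLinearMap', Nat.cast_ofNat, Nat.add_one_sub_one, pow_one] at this
  linear_combination this
    - 2 * m * (k₁ - k₂ + k₃ * normSq a b x) * formAt b x w * h.metric_eq x hx u v

lemma isDualJetAt (h : IsDeformedOn k₁ k₂ k₃ f U a b a' b') (hx : x ∈ U)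
    {θ : (Fin n → ℝ) →ₗ[ℝ] ℝ} (hj : IsFlatJetAt k₁ k₂ k₃ a b x θ m) :
    IsDualJetAt a' b' x (θ + ((k₂ - k₃ * normSq a b x) / 2 * m) • formAt b x)
      (-2 * m * √(deformQ k₂ k₃ (normSq a b x)) * f (normSq a b x)) := by
  have hf := (h.factor x hx).pos
  have ht := hj.hasFDerivAt_normSq h.isOpen h.metric h.form hx
  have hT := h.metricJet_eq hx ht
  have hS := h.formJet_eq hx ht
  have ha := h.metric_eq x hx
  have hb := h.form_eq x hx
  have hQ : deformQ k₂ k₃ (normSq a b x) = 1 + k₂ * normSq a b x - k₃ * normSq a b x ^ 2 := rfl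
  simp only [hj.metric, hj.form] at hT hS
  generalize normSq a b x = t at *
  constructor
  · intro u v w
    refine mul_left_cancel₀ (pow_pos hf 2).ne' ?_
    simp only [LinearMap.add_apply, LinearMap.smul_apply, smul_eq_mul]
    rw [hQ] at hT
    linear_combination hT u v w - 4 * (θ u + (k₂ - k₃ * t) / 2 * m * formAt b x u) * ha v w
      - 4 * (θ v + (k₂ - k₃ * t) / 2 * m * formAt b x v) * ha u w
      - 4 * (θ w + (k₂ - k₃ * t) / 2 * m * formAt b x w) * ha u v
  · intro u v
    refine mul_left_cancel₀ hf.ne' ?_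
    simp only [LinearMap.add_apply, LinearMap.smul_apply, smul_eq_mul]
    linear_combination hS u v - 4 * (θ u + (k₂ - k₃ * t) / 2 * m * formAt b x u) * hb v
      - 2 * (θ v + (k₂ - k₃ * t) / 2 * m * formAt b x v) * hb u
      + 2 * m * √(deformQ k₂ k₃ t) * ha u v

lemma hasFDerivAt_normSq_of_isDualJetAt (h : IsDeformedOn k₁ k₂ k₃ f U a b a' b') (hx : x ∈ U)
    {θ' : (Fin n → ℝ) →ₗ[ℝ] ℝ} (hj : IsDualJetAt a' b' x θ'
      (-2 * m * √(deformQ k₂ k₃ (normSq a b x)) * f (normSq a b x))) :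
    HasFDerivAt (normSq a b)
      ((4 * m * deformQ k₂ k₃ (normSq a b x)) • (formAt b x).toContinuousLinearMap) x := by
  have hnorm : normSq a b =ᶠ[𝓝 x] normSq a' b' :=
    Filter.eventually_of_mem (h.isOpen.mem_nhds hx) fun x' hx' => (h.normSq_eq hx').symm
  refine ((hj.hasFDerivAt_normSq h.isOpen h.metric' h.form' hx).congr_of_eventuallyEq
    hnorm).congr_fderiv (ContinuousLinearMap.ext fun w => ?_)
  simp only [smul_apply, LinearMap.coe_toContinuousLinearMap', smul_eq_mul]
  linear_combination -4 * m * √(deformQ k₂ k₃ (normSq a b x)) * h.form_eq x hx w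
    + 4 * m * formAt b x w * Real.sq_sqrt (h.pos x hx).le

lemma exists_isFlatJetAt (h : IsDeformedOn k₁ k₂ k₃ f U a b a' b') (hx : x ∈ U)
    {θ' : (Fin n → ℝ) →ₗ[ℝ] ℝ} {c : ℝ} (hj : IsDualJetAt a' b' x θ' c) :
    ∃ θ m, IsFlatJetAt k₁ k₂ k₃ a b x θ m := by
  have hf := (h.factor x hx).pos
  have hr := Real.sqrt_pos.2 (h.pos x hx)
  have ha := h.metric_eq x hx
  have hb := h.form_eq x hx
  obtain ⟨m, rfl⟩ : ∃ m, c = -2 * m * √(deformQ k₂ k₃ (normSq a b x)) * f (normSq a b x) :=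
    ⟨-c / (2 * √(deformQ k₂ k₃ (normSq a b x)) * f (normSq a b x)), by field_simp⟩
  have ht := h.hasFDerivAt_normSq_of_isDualJetAt hx hj
  have hT := h.metricJet_eq hx ht
  have hS := h.formJet_eq hx ht
  have hQ : deformQ k₂ k₃ (normSq a b x) = 1 + k₂ * normSq a b x - k₃ * normSq a b x ^ 2 := rfl
  simp only [hj.metric, hj.form] at hT hS
  generalize normSq a b x = t at *
  set θ := θ' + (-((k₂ - k₃ * t) / 2 * m)) • formAt b x with hθ
  have θ_apply (u : Fin n → ℝ) : θ u = θ' u - (k₂ - k₃ * t) / 2 * m * formAt b x u := by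
    rw [hθ, LinearMap.add_apply, LinearMap.smul_apply, smul_eq_mul]
    ring
  have hform (u v : Fin n → ℝ) : formJet b x u v = 4 * θ u * formAt b x v + 2 * θ v * formAt b x u
      + m * (2 * metricAt a x u v + (k₁ + 2 * k₂) * formAt b x u * formAt b x v) := by
    refine mul_left_cancel₀ hr.ne' ?_
    rw [θ_apply, θ_apply]
    linear_combination hS u v - 4 * θ' u * hb v - 2 * θ' v * hb u
      + 2 * m * √(deformQ k₂ k₃ t) * ha u v
  refine ⟨θ, m, fun u v w => ?_, hform⟩
  simp only [hform, θ_apply, hQ] at hT ⊢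
  linear_combination -hT u v w + 4 * θ' u * ha v w + 4 * θ' v * ha u w + 4 * θ' w * ha u v

end IsDeformedOn

end Deformation

section UniqueContinuation

variable {E F : Type*} [NormedAddCommGroup E] [NormedSpace ℝ E] [NormedAddCommGroup F]
  [NormedSpace ℝ F]

lemma eq_zero_of_norm_fderiv_le_of_convex {s : Set E} (hs : Convex ℝ s) {w : E → F} {C : ℝ}
    (hw : ∀ x ∈ s, DifferentiableAt ℝ w x) (hC : ∀ x ∈ s, ‖fderiv ℝ w x‖ ≤ C * ‖w x‖) {x y : E}
    (hx : x ∈ s) (hy : y ∈ s) (hwx : w x = 0) : w y = 0 := by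
  set γ : ℝ → E := ⇑(AffineMap.lineMap (k := ℝ) x y)
  have hγ (r : ℝ) (hr : r ∈ Set.Icc (0 : ℝ) 1) : γ r ∈ s := hs.lineMap_mem hx hy hr
  have hderiv (r : ℝ) (hr : r ∈ Set.Icc (0 : ℝ) 1) :
      HasDerivAt (w ∘ γ) (fderiv ℝ w (γ r) (y - x)) r :=
    (hw _ (hγ r hr)).hasFDerivAt.comp_hasDerivAt r AffineMap.hasDerivAt_lineMap
  have hbound (r : ℝ) (hr : r ∈ Set.Ico (0 : ℝ) 1) :
      ‖fderiv ℝ w (γ r) (y - x)‖ ≤ C * ‖y - x‖ * ‖(w ∘ γ) r‖ + 0 := by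
    calc ‖fderiv ℝ w (γ r) (y - x)‖
        ≤ ‖fderiv ℝ w (γ r)‖ * ‖y - x‖ := ContinuousLinearMap.le_opNorm ..
      _ ≤ C * ‖w (γ r)‖ * ‖y - x‖ := by
        gcongr
        exact hC _ (hγ r (Set.Ico_subset_Icc_self hr))
      _ = C * ‖y - x‖ * ‖(w ∘ γ) r‖ + 0 := by
        rw [Function.comp_apply]
        ring
  have hgronwall := norm_le_gronwallBound_of_norm_deriv_right_le (δ := 0)
    (fun r hr => (hderiv r hr).continuousAt.continuousWithinAt)
    (fun r hr => (hderiv r (Set.Ico_subset_Icc_self hr)).hasDerivWithinAt)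
    (by simp [γ, hwx]) hbound 1 (Set.right_mem_Icc.2 zero_le_one)
  simpa [γ, gronwallBound_ε0_δ0] using hgronwall

lemma eq_zero_of_fderiv_isBigO {U : Set E} (hU : IsOpen U) {w : E → F}
    (hw : DifferentiableOn ℝ w U) (hO : ∀ x ∈ U, fderiv ℝ w =O[𝓝 x] w) {x y : E} (hx : x ∈ U)
    (hwx : w x = 0) (hy : y ∈ connectedComponentIn U x) : w y = 0 := by
  have hlocal (z : E) (hz : z ∈ U) : ∃ s ∈ 𝓝 z, ∀ p ∈ s, w p = 0 → ∀ q ∈ s, w q = 0 := by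
    obtain ⟨C, hC⟩ := (hO z hz).bound
    obtain ⟨ε, hε, hball⟩ := Metric.eventually_nhds_iff_ball.1 (hC.and (hU.mem_nhds hz))
    exact ⟨_, Metric.ball_mem_nhds z hε, fun p hp hwp q hq =>
      eq_zero_of_norm_fderiv_le_of_convex (convex_ball z ε)
        (fun r hr => hw.differentiableAt (hU.mem_nhds (hball r hr).2)) (fun r hr => (hball r hr).1)
        hp hq hwp⟩
  have hopen : IsOpen {z | z ∈ U ∧ w z = 0} := isOpen_iff_mem_nhds.2 fun z ⟨hz, hwz⟩ => by
    obtain ⟨s, hs, hzero⟩ := hlocal z hz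
    filter_upwards [hs, hU.mem_nhds hz] with p hp hpU
    exact ⟨hpU, hzero z (mem_of_mem_nhds hs) hwz p hp⟩
  refine (isPreconnected_connectedComponentIn.subset_of_closure_inter_subset hopen
    ⟨x, mem_connectedComponentIn hx, hx, hwx⟩ fun z ⟨hcl, hzx⟩ => ?_) hy |>.2
  have hz := connectedComponentIn_subset U x hzx
  obtain ⟨s, hs, hzero⟩ := hlocal z hz
  obtain ⟨p, hps, -, hwp⟩ := mem_closure_iff_nhds.1 hcl s hs
  exact ⟨hz, hzero p hps hwp z (mem_of_mem_nhds hs)⟩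

end UniqueContinuation

section Traces

variable {n : ℕ} {U : Set (Fin n → ℝ)} {a : (Fin n → ℝ) → Matrix (Fin n) (Fin n) ℝ}
  {b : (Fin n → ℝ) → Fin n → ℝ} {x : Fin n → ℝ}

/-- The trace `a^{ij}(x) B_ij` of a bilinear form. -/
def metricTrace (a : (Fin n → ℝ) → Matrix (Fin n) (Fin n) ℝ) (x : Fin n → ℝ) :
    BilinForm ℝ (Fin n → ℝ) →ₗ[ℝ] ℝ :=
  Matrix.traceLinearMap (Fin n) ℝ ℝ ∘ₗ LinearMap.mulLeft ℝ (a x)⁻¹ ∘ₗ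
    LinearMap.BilinForm.toMatrix'.toLinearMap

lemma metricTrace_eq_sum (B : BilinForm ℝ (Fin n → ℝ)) :
    metricTrace a x B = ∑ i, ∑ j, (a x)⁻¹ i j * B (Pi.single j 1) (Pi.single i 1) := by
  simp [metricTrace, Matrix.trace, Matrix.mul_apply, LinearMap.BilinForm.toMatrix'_apply]

lemma metricTrace_metricAt (h : (a x).PosDef) : metricTrace a x (metricAt a x) = n := by
  simp [metricTrace, Matrix.nonsing_inv_mul _ h.det_pos.ne'.isUnit]

lemma metricTrace_smulRight (ξ η : (Fin n → ℝ) →ₗ[ℝ] ℝ) :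
    metricTrace a x (ξ.smulRight η) = η (raise a x fun i => ξ (Pi.single i 1)) := by
  rw [metricTrace_eq_sum, ← sum_apply_single_mul]
  refine Finset.sum_congr rfl fun i _ => ?_
  simp only [LinearMap.smulRight_apply, LinearMap.smul_apply, smul_eq_mul, raise, Matrix.mulVec,
    dotProduct, Finset.mul_sum]
  exact Finset.sum_congr rfl fun j _ => by ring

lemma metricTrace_smulRight_metricAt (h : (a x).PosDef) (ξ : (Fin n → ℝ) →ₗ[ℝ] ℝ)
    (w : Fin n → ℝ) : metricTrace a x (ξ.smulRight (metricAt a x w)) = ξ w := by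
  rw [metricTrace_smulRight, metricAt_raise h, dotProductBilin_single]

lemma metricTrace_metricAt_smulRight (h : (a x).PosDef) (ξ : (Fin n → ℝ) →ₗ[ℝ] ℝ)
    (w : Fin n → ℝ) : metricTrace a x ((metricAt a x w).smulRight ξ) = ξ w := by
  have hraise : raise a x (fun i => metricAt a x w (Pi.single i 1)) = w :=
    eq_of_metricAt_eq h fun z => by
      rw [metricAt_raise h, dotProductBilin_single, (metricAt_isSymm h).eq]
  rw [metricTrace_smulRight, hraise]

lemma smoothOn_fderiv_apply {E : Type*} [NormedAddCommGroup E] [NormedSpace ℝ E] {U : Set E}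
    {f : E → ℝ} (hU : IsOpen U) (hf : ContDiffOn ℝ ∞ f U) (w : E) :
    ContDiffOn ℝ ∞ (fun x => fderiv ℝ f x w) U :=
  (hf.fderiv_of_isOpen (m := ∞) hU (by simp)).clm_apply contDiffOn_const

lemma IsOneFormOn.smoothOn_formAt (hb : IsOneFormOn U b) (u : Fin n → ℝ) :
    ContDiffOn ℝ ∞ (fun x => formAt b x u) U :=
  ContDiffOn.sum (s := Finset.univ) fun i _ => (hb i).mul contDiffOn_const

lemma IsOneFormOn.smoothOn_formJet (hU : IsOpen U) (hb : IsOneFormOn U b) (u w : Fin n → ℝ) :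
    ContDiffOn ℝ ∞ (fun x => formJet b x u w) U :=
  (smoothOn_fderiv_apply hU (hb.smoothOn_formAt u) w).congr fun x hx => by
    rw [(hb.hasFDerivAt hU hx u).fderiv, LinearMap.coe_toContinuousLinearMap']

namespace IsRiemannianMetricOn

lemma smoothOn_metricAt (ha : IsRiemannianMetricOn U a) (u v : Fin n → ℝ) :
    ContDiffOn ℝ ∞ (fun x => metricAt a x u v) U := by
  simp only [Matrix.toBilin'_apply]
  exact ContDiffOn.sum fun i _ => ContDiffOn.sum fun j _ =>
    (contDiffOn_const.mul (ha.smooth i j)).mul contDiffOn_const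

lemma smoothOn_metricJet (hU : IsOpen U) (ha : IsRiemannianMetricOn U a) (u v w : Fin n → ℝ) :
    ContDiffOn ℝ ∞ (fun x => metricJet a x u v w) U :=
  (smoothOn_fderiv_apply hU (ha.smoothOn_metricAt u v) w).congr fun x hx => by
    rw [(ha.hasFDerivAt hU hx u v).fderiv, LinearMap.coe_toContinuousLinearMap']

lemma smoothOn_metricTrace (ha : IsRiemannianMetricOn U a)
    {B : (Fin n → ℝ) → BilinForm ℝ (Fin n → ℝ)}
    (hB : ∀ u v, ContDiffOn ℝ ∞ (fun x => B x u v) U) :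
    ContDiffOn ℝ ∞ (fun x => metricTrace a x (B x)) U := by
  simp only [metricTrace_eq_sum]
  exact ContDiffOn.sum fun i _ => ContDiffOn.sum fun j _ => (ha.smoothOn_inv i j).mul (hB _ _)

end IsRiemannianMetricOn

/-- The 1-form `a^{ij} ∂_k a_ij / (4 (n + 2))`; it is the 1-form of every dual jet. -/
def traceForm (a : (Fin n → ℝ) → Matrix (Fin n) (Fin n) ℝ) (x : Fin n → ℝ) (k : Fin n) : ℝ :=
  1 / (4 * (n + 2)) * metricTrace a x
    (LinearMap.compr₂ (metricJet a x) (LinearMap.applyₗ (Pi.single k 1 : Fin n → ℝ)))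

/-- The function `a^{ij} (∂_j b_i - 4 θ_i b_j - 2 θ_j b_i) / n` with `θ = traceForm a`; it is the
scalar of every dual jet. -/
def traceScalar (a : (Fin n → ℝ) → Matrix (Fin n) (Fin n) ℝ) (b : (Fin n → ℝ) → Fin n → ℝ)
    (x : Fin n → ℝ) : ℝ :=
  1 / n * (metricTrace a x (formJet b x)
    - metricTrace a x ((4 : ℝ) • (formAt (traceForm a) x).smulRight (formAt b x)
      + (2 : ℝ) • (formAt b x).smulRight (formAt (traceForm a) x)))

lemma isOneFormOn_traceForm (hU : IsOpen U) (ha : IsRiemannianMetricOn U a) :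
    IsOneFormOn U (traceForm a) := fun _ =>
  contDiffOn_const.mul (ha.smoothOn_metricTrace fun u v => ha.smoothOn_metricJet hU u v _)

lemma smoothOn_traceScalar (hU : IsOpen U) (ha : IsRiemannianMetricOn U a)
    (hb : IsOneFormOn U b) : ContDiffOn ℝ ∞ (traceScalar a b) U := by
  have hθ := isOneFormOn_traceForm hU ha
  exact contDiffOn_const.mul ((ha.smoothOn_metricTrace (hb.smoothOn_formJet hU)).sub
    (ha.smoothOn_metricTrace fun u v =>
      (contDiffOn_const.mul ((hθ.smoothOn_formAt u).mul (hb.smoothOn_formAt v))).add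
        (contDiffOn_const.mul ((hb.smoothOn_formAt u).mul (hθ.smoothOn_formAt v)))))

namespace IsDualJetAt

variable {θ : (Fin n → ℝ) →ₗ[ℝ] ℝ} {m : ℝ}

lemma formAt_traceForm (hp : (a x).PosDef) (h : IsDualJetAt a b x θ m) :
    formAt (traceForm a) x = θ := by
  have hslice (w : Fin n → ℝ) : LinearMap.compr₂ (metricJet a x) (LinearMap.applyₗ w)
      = (4 : ℝ) • (θ.smulRight (metricAt a x w) + (metricAt a x w).smulRight θ
        + θ w • metricAt a x) := by
    refine LinearMap.ext₂ fun u v => ?_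
    simp only [LinearMap.compr₂_apply, LinearMap.applyₗ_apply_apply, h.metric,
      LinearMap.smul_apply, LinearMap.add_apply, LinearMap.smulRight_apply, smul_eq_mul,
      (metricAt_isSymm hp).eq w]
    ring
  have hcoeff : traceForm a x = fun k => θ (Pi.single k 1) := by
    ext k
    rw [traceForm, hslice]
    simp only [map_smul, map_add, metricTrace_smulRight_metricAt hp,
      metricTrace_metricAt_smulRight hp, metricTrace_metricAt hp, smul_eq_mul]
    field_simp
    ring
  rw [formAt, hcoeff, dotProductBilin_single]

lemma traceScalar_eq (hn : n ≠ 0) (hp : (a x).PosDef) (h : IsDualJetAt a b x θ m) :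
    traceScalar a b x = m := by
  have hform : formJet b x = (4 : ℝ) • θ.smulRight (formAt b x)
      + (2 : ℝ) • (formAt b x).smulRight θ + m • metricAt a x := by
    refine LinearMap.ext₂ fun u v => ?_
    simp only [h.form, LinearMap.smul_apply, LinearMap.add_apply,
      LinearMap.smulRight_apply, smul_eq_mul]
    ring
  rw [traceScalar, h.formAt_traceForm hp, hform, map_add _ _ (m • metricAt a x),
    add_sub_cancel_left, map_smul, metricTrace_metricAt hp, smul_eq_mul]
  field_simp

lemma trace (hn : n ≠ 0) (hp : (a x).PosDef) (h : IsDualJetAt a b x θ m) :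
    IsDualJetAt a b x (formAt (traceForm a) x) (traceScalar a b x) := by
  rwa [h.formAt_traceForm hp, h.traceScalar_eq hn hp]

lemma of_mem_closure (hU : IsOpen U) (ha : IsRiemannianMetricOn U a) (hb : IsOneFormOn U b)
    {W : Set (Fin n → ℝ)}
    (h : ∀ x ∈ W, IsDualJetAt a b x (formAt (traceForm a) x) (traceScalar a b x)) (hx : x ∈ U)
    (hxW : x ∈ closure W) : IsDualJetAt a b x (formAt (traceForm a) x) (traceScalar a b x) := by
  have hW := mem_closure_iff_frequently.1 hxW
  have continuousAt {f : (Fin n → ℝ) → ℝ} (hf : ContDiffOn ℝ ∞ f U) : ContinuousAt f x :=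
    (differentiableAt_of_smoothOn hU hf hx).continuousAt
  have hG (u v : Fin n → ℝ) := continuousAt (ha.smoothOn_metricAt u v)
  have hβ (u : Fin n → ℝ) := continuousAt (hb.smoothOn_formAt u)
  have hθ (u : Fin n → ℝ) := continuousAt ((isOneFormOn_traceForm hU ha).smoothOn_formAt u)
  have hm := continuousAt (smoothOn_traceScalar hU ha hb)
  constructor
  · intro u v w
    exact tendsto_nhds_unique_of_frequently_eq (continuousAt (ha.smoothOn_metricJet hU u v w))
      ((((hθ u).mul (hG v w)).add ((hθ v).mul (hG u w))).add ((hθ w).mul (hG u v)) |>.const_mul 4)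
      (hW.mono fun y hy => (h y hy).metric u v w)
  · intro u v
    exact tendsto_nhds_unique_of_frequently_eq (continuousAt (hb.smoothOn_formJet hU u v))
      (((((hθ u).const_mul 4).mul (hβ v)).add (((hθ v).const_mul 2).mul (hβ u))).add
        (hm.mul (hG u v)))
      (hW.mono fun y hy => (h y hy).form u v)

end IsDualJetAt

end Traces

section ZerosOfTheForm

open Asymptotics

lemma fderiv_fderiv_apply_comm {E : Type*} [NormedAddCommGroup E] [NormedSpace ℝ E] {U : Set E}
    {f : E → ℝ} {x : E} (hU : IsOpen U) (hf : ContDiffOn ℝ ∞ f U) (hx : x ∈ U) (v w : E) :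
    fderiv ℝ (fun y => fderiv ℝ f y v) x w = fderiv ℝ (fun y => fderiv ℝ f y w) x v := by
  have hsymm : IsSymmSndFDerivAt ℝ f x :=
    (hf.contDiffAt (hU.mem_nhds hx)).isSymmSndFDerivAt
      (by rw [minSmoothness_of_isRCLikeNormedField]; exact ENat.LEInfty.out)
  have hd : DifferentiableAt ℝ (fderiv ℝ f) x :=
    ((hf.fderiv_of_isOpen (m := ∞) hU (by simp)).contDiffAt (hU.mem_nhds hx)).differentiableAt
      (by simp)
  rw [fderiv_clm_apply hd (differentiableAt_const v),
    fderiv_clm_apply hd (differentiableAt_const w)]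
  simpa using hsymm w v

lemma isBigO_mul_of_continuousAt {X F : Type*} [TopologicalSpace X] [NormedAddCommGroup F]
    [NormedSpace ℝ F] {f g : X → ℝ} {w : X → F} {x : X} (hf : ContinuousAt f x)
    (hg : g =O[𝓝 x] w) : (fun y => f y * g y) =O[𝓝 x] w := by
  simpa using (hf.isBigO_one ℝ).smul hg

lemma isBigO_of_apply_single {α F G : Type*} {n : ℕ} [NormedAddCommGroup F] [NormedSpace ℝ F]
    [Norm G] {l : Filter α} {L : α → (Fin n → ℝ) →L[ℝ] F} {g : α → G}
    (h : ∀ k, (fun x => L x (Pi.single k 1)) =O[l] g) : L =O[l] g := by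
  have hsum (x : α) : L x = ∑ k, ContinuousLinearMap.smulRightL ℝ (Fin n → ℝ) F
      (ContinuousLinearMap.proj k) (L x (Pi.single k 1)) := by
    ext1 y
    conv_lhs => rw [← (Pi.basisFun ℝ (Fin n)).sum_repr y]
    simp
  rw [funext hsum]
  exact IsBigO.fun_sum fun k _ => (ContinuousLinearMap.isBigO_comp _ _ _).trans (h k)

variable {n : ℕ} {U : Set (Fin n → ℝ)} {a : (Fin n → ℝ) → Matrix (Fin n) (Fin n) ℝ}
  {b θ : (Fin n → ℝ) → Fin n → ℝ} {m : (Fin n → ℝ) → ℝ} {x : Fin n → ℝ}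

/-- The part of `∂_z` of `4 θ_u b_w + 2 θ_w b_u + m a_uw` that does not contain `∂_z m`. -/
def jetRemainder (a : (Fin n → ℝ) → Matrix (Fin n) (Fin n) ℝ) (b θ : (Fin n → ℝ) → Fin n → ℝ)
    (m : (Fin n → ℝ) → ℝ) (x u w z : Fin n → ℝ) : ℝ :=
  4 * (formAt θ x u * formJet b x w z + formJet θ x u z * formAt b x w)
    + 2 * (formAt θ x w * formJet b x u z + formJet θ x w z * formAt b x u)
    + metricJet a x u w z * m x

/-- A solution on `U` of the second equation of `IsDualJetAt`, with smooth coefficients. -/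
structure IsFormSystemOn (U : Set (Fin n → ℝ)) (a : (Fin n → ℝ) → Matrix (Fin n) (Fin n) ℝ)
    (b θ : (Fin n → ℝ) → Fin n → ℝ) (m : (Fin n → ℝ) → ℝ) : Prop where
  isOpen : IsOpen U
  metric : IsRiemannianMetricOn U a
  form : IsOneFormOn U b
  form_coeff : IsOneFormOn U θ
  scalar : ContDiffOn ℝ ∞ m U
  formJet_eq : ∀ x ∈ U, ∀ u v, formJet b x u v
    = 4 * formAt θ x u * formAt b x v + 2 * formAt θ x v * formAt b x u + m x * metricAt a x u v

namespace IsFormSystemOn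

lemma fderiv_formJet (h : IsFormSystemOn U a b θ m) (hx : x ∈ U) (u w z : Fin n → ℝ) :
    fderiv ℝ (fun y => formJet b y u w) x z
      = fderiv ℝ m x z * metricAt a x u w + jetRemainder a b θ m x u w z := by
  have hθ := h.form_coeff.hasFDerivAt h.isOpen hx
  have hb := h.form.hasFDerivAt h.isOpen hx
  have hm := (differentiableAt_of_smoothOn h.isOpen h.scalar hx).hasFDerivAt
  have hderiv := ((((hθ u).const_mul 4).mul (hb w)).add (((hθ w).const_mul 2).mul (hb u))).add
    (hm.mul (h.metric.hasFDerivAt h.isOpen hx u w))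
  have heq := Filter.eventually_of_mem (h.isOpen.mem_nhds hx) fun y hy => h.formJet_eq y hy u w
  rw [(hderiv.congr_of_eventuallyEq heq).fderiv, jetRemainder]
  simp only [add_apply, smul_apply, LinearMap.coe_toContinuousLinearMap', smul_eq_mul]
  ring

lemma fderiv_scalar_mul_metricAt (h : IsFormSystemOn U a b θ m) (hx : x ∈ U)
    (u w z : Fin n → ℝ) :
    fderiv ℝ m x z * metricAt a x u w - fderiv ℝ m x w * metricAt a x u z
      = jetRemainder a b θ m x u z w - jetRemainder a b θ m x u w z := by
  have hjet (v : Fin n → ℝ) :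
      (fun y => fderiv ℝ (fun x' => formAt b x' u) y v) =ᶠ[𝓝 x] fun y => formJet b y u v := by
    filter_upwards [h.isOpen.mem_nhds hx] with y hy
    rw [(h.form.hasFDerivAt h.isOpen hy u).fderiv, LinearMap.coe_toContinuousLinearMap']
  have hcomm := fderiv_fderiv_apply_comm h.isOpen (h.form.smoothOn_formAt u) hx w z
  rw [(hjet w).fderiv_eq, (hjet z).fderiv_eq, h.fderiv_formJet hx, h.fderiv_formJet hx] at hcomm
  linear_combination hcomm

lemma fderiv_scalar_eq (h : IsFormSystemOn U a b θ m) (hx : x ∈ U) (z : Fin n → ℝ) :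
    (n - 1) * fderiv ℝ m x z = ∑ i, ∑ j, (a x)⁻¹ i j
      * (jetRemainder a b θ m x (Pi.single j 1) z (Pi.single i 1)
        - jetRemainder a b θ m x (Pi.single j 1) (Pi.single i 1) z) := by
  have hp := h.metric.posDef x hx
  have htrace : metricTrace a x (fderiv ℝ m x z • metricAt a x
      + (-1 : ℝ) • (metricAt a x z).smulRight (fderiv ℝ m x).toLinearMap)
      = (n - 1) * fderiv ℝ m x z := by
    simp only [map_add, map_smul, metricTrace_metricAt hp, metricTrace_metricAt_smulRight hp,
      smul_eq_mul, ContinuousLinearMap.coe_coe]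
    ring
  rw [← htrace, metricTrace_eq_sum]
  refine Finset.sum_congr rfl fun i _ => Finset.sum_congr rfl fun j _ => ?_
  rw [← h.fderiv_scalar_mul_metricAt hx, ← (metricAt_isSymm hp).eq z]
  simp only [LinearMap.add_apply, LinearMap.smul_apply, LinearMap.smulRight_apply, smul_eq_mul,
    ContinuousLinearMap.coe_coe]
  ring

lemma formAt_isBigO (b : (Fin n → ℝ) → Fin n → ℝ) (m : (Fin n → ℝ) → ℝ) (x v : Fin n → ℝ) :
    (fun y => formAt b y v) =O[𝓝 x] fun y => (b y, m y) :=
  ((dotProductBilin ℝ ℝ).flip v ∘ₗ LinearMap.fst ℝ (Fin n → ℝ) ℝ).toContinuousLinearMap.isBigO_comp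
    (fun y => (b y, m y)) _

lemma formJet_isBigO (h : IsFormSystemOn U a b θ m) (hx : x ∈ U) (u v : Fin n → ℝ) :
    (fun y => formJet b y u v) =O[𝓝 x] fun y => (b y, m y) := by
  have hθ (u : Fin n → ℝ) := (h.form_coeff.hasFDerivAt h.isOpen hx u).continuousAt
  have hsum := ((isBigO_mul_of_continuousAt ((hθ u).const_mul 4) (formAt_isBigO b m x v)).add
    (isBigO_mul_of_continuousAt ((hθ v).const_mul 2) (formAt_isBigO b m x u))).add
    (isBigO_mul_of_continuousAt (h.metric.hasFDerivAt h.isOpen hx u v).continuousAt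
      isBigO_snd_prod')
  refine hsum.congr' ?_ .rfl
  filter_upwards [h.isOpen.mem_nhds hx] with y hy
  rw [h.formJet_eq y hy]
  ring

lemma jetRemainder_isBigO (h : IsFormSystemOn U a b θ m) (hx : x ∈ U) (u w z : Fin n → ℝ) :
    (fun y => jetRemainder a b θ m y u w z) =O[𝓝 x] fun y => (b y, m y) := by
  have continuousAt {f : (Fin n → ℝ) → ℝ} (hf : ContDiffOn ℝ ∞ f U) : ContinuousAt f x :=
    (differentiableAt_of_smoothOn h.isOpen hf hx).continuousAt
  have hθ (u : Fin n → ℝ) := continuousAt (h.form_coeff.smoothOn_formAt u)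
  have hθJ (u v : Fin n → ℝ) := continuousAt (h.form_coeff.smoothOn_formJet h.isOpen u v)
  have hT := continuousAt (h.metric.smoothOn_metricJet h.isOpen u w z)
  have hterm (u w : Fin n → ℝ) : (fun y => formAt θ y u * formJet b y w z
      + formJet θ y u z * formAt b y w) =O[𝓝 x] fun y => (b y, m y) :=
    (isBigO_mul_of_continuousAt (hθ u) (h.formJet_isBigO hx w z)).add
      (isBigO_mul_of_continuousAt (hθJ u z) (formAt_isBigO b m x w))
  exact (((hterm u w).const_mul_left 4).add ((hterm w u).const_mul_left 2)).add
    (isBigO_mul_of_continuousAt hT isBigO_snd_prod)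

lemma fderiv_scalar_isBigO (h : IsFormSystemOn U a b θ m) (hn : 2 ≤ n) (hx : x ∈ U)
    (z : Fin n → ℝ) : (fun y => fderiv ℝ m y z) =O[𝓝 x] fun y => (b y, m y) := by
  have hn1 : (n - 1 : ℝ) ≠ 0 := by
    have : (2 : ℝ) ≤ n := mod_cast hn
    linarith
  rw [← isBigO_const_mul_left_iff hn1]
  have hinv (i j : Fin n) : ContinuousAt (fun y => (a y)⁻¹ i j) x :=
    (differentiableAt_of_smoothOn h.isOpen (h.metric.smoothOn_inv i j) hx).continuousAt
  have hsum := IsBigO.fun_sum (s := Finset.univ) fun i _ =>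
    IsBigO.fun_sum (s := Finset.univ) fun j _ => isBigO_mul_of_continuousAt (hinv i j)
      ((h.jetRemainder_isBigO hx (Pi.single j 1) z (Pi.single i 1)).sub
        (h.jetRemainder_isBigO hx (Pi.single j 1) (Pi.single i 1) z))
  refine hsum.congr' ?_ .rfl
  filter_upwards [h.isOpen.mem_nhds hx] with y hy
  exact (h.fderiv_scalar_eq hy z).symm

lemma hasFDerivAt_prodMk (h : IsFormSystemOn U a b θ m) (hx : x ∈ U) :
    HasFDerivAt (fun y => (b y, m y)) ((ContinuousLinearMap.pi fun i =>
      (formJet b x (Pi.single i 1)).toContinuousLinearMap).prod (fderiv ℝ m x)) x := by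
  refine (hasFDerivAt_pi.2 fun i => ?_).prodMk
    (differentiableAt_of_smoothOn h.isOpen h.scalar hx).hasFDerivAt
  simpa using h.form.hasFDerivAt h.isOpen hx (Pi.single i 1)

lemma fderiv_prodMk_isBigO (h : IsFormSystemOn U a b θ m) (hn : 2 ≤ n) (hx : x ∈ U) :
    fderiv ℝ (fun y => (b y, m y)) =O[𝓝 x] fun y => (b y, m y) := by
  refine isBigO_of_apply_single fun k => ?_
  have hprod := (isBigO_pi.2 fun i => h.formJet_isBigO hx (Pi.single i 1) (Pi.single k 1)).prod_left
    (h.fderiv_scalar_isBigO hn hx (Pi.single k 1))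
  refine hprod.congr' ?_ .rfl
  filter_upwards [h.isOpen.mem_nhds hx] with y hy
  rw [(h.hasFDerivAt_prodMk hy).fderiv]
  rfl

lemma form_eq_zero (h : IsFormSystemOn U a b θ m) (hn : 2 ≤ n) (hx : x ∈ U) (hb : b x = 0)
    (hm : m x = 0) {y : Fin n → ℝ} (hy : y ∈ connectedComponentIn U x) : b y = 0 :=
  congr_arg Prod.fst (eq_zero_of_fderiv_isBigO h.isOpen
    (fun _ hz => (h.hasFDerivAt_prodMk hz).differentiableAt.differentiableWithinAt)
    (fun _ hz => h.fderiv_prodMk_isBigO hn hz) hx (Prod.ext hb hm) hy)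

end IsFormSystemOn

end ZerosOfTheForm

section DualJetsAcrossZeros

variable {n : ℕ} {U : Set (Fin n → ℝ)} {a : (Fin n → ℝ) → Matrix (Fin n) (Fin n) ℝ}
  {b : (Fin n → ℝ) → Fin n → ℝ} {x : Fin n → ℝ}

lemma formJet_eq_zero (hb : b =ᶠ[𝓝 x] 0) : formJet b x = 0 := by
  refine LinearMap.pi_ext' fun i => LinearMap.ext_ring <| LinearMap.pi_ext' fun k =>
    LinearMap.ext_ring ?_
  have hcoord : (fun y => b y i) =ᶠ[𝓝 x] 0 := hb.mono fun y hy => congr_fun hy i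
  simp [formJet_single, pd, hcoord.fderiv_eq]

lemma traceScalar_eq_zero (hb : b =ᶠ[𝓝 x] 0) : traceScalar a b x = 0 := by
  have hform : formAt b x = 0 := by rw [formAt, hb.eq_of_nhds, Pi.zero_apply, map_zero]
  simp [traceScalar, formJet_eq_zero hb, hform]

lemma form_eq_zero_of_notMem_closure (hn : 2 ≤ n) (hU : IsOpen U)
    (ha : IsRiemannianMetricOn U a) (hb : IsOneFormOn U b)
    (h : ∀ x ∈ U, b x ≠ 0 → IsDualJetAt a b x (formAt (traceForm a) x) (traceScalar a b x))
    (hx : x ∈ U) (hcl : x ∉ closure {x | x ∈ U ∧ b x ≠ 0}) {y : Fin n → ℝ}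
    (hy : y ∈ connectedComponentIn U x) : b y = 0 := by
  have eventuallyEq_zero {z : Fin n → ℝ} (hz : z ∈ U)
      (hcl : z ∉ closure {x | x ∈ U ∧ b x ≠ 0}) : b =ᶠ[𝓝 z] 0 := by
    filter_upwards [hU.mem_nhds hz, isClosed_closure.isOpen_compl.mem_nhds hcl] with q hqU hq
    exact by_contra fun hbq => hq (subset_closure ⟨hqU, hbq⟩)
  have hsystem : IsFormSystemOn U a b (traceForm a) (traceScalar a b) :=
    { isOpen := hU
      metric := ha
      form := hb
      form_coeff := isOneFormOn_traceForm hU ha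
      scalar := smoothOn_traceScalar hU ha hb
      formJet_eq := fun z hz u v => by
        by_cases hzcl : z ∈ closure {x | x ∈ U ∧ b x ≠ 0}
        · exact (IsDualJetAt.of_mem_closure hU ha hb (fun q hq => h q hq.1 hq.2) hz hzcl).form u v
        · have hbz := eventuallyEq_zero hz hzcl
          simp [formJet_eq_zero hbz, traceScalar_eq_zero hbz, hbz.eq_of_nhds] }
  have hbx := eventuallyEq_zero hx hcl
  exact hsystem.form_eq_zero hn hx hbx.eq_of_nhds (traceScalar_eq_zero hbx) hy

end DualJetsAcrossZeros

section Deformation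

variable {n : ℕ} {U : Set (Fin n → ℝ)} {a a' : (Fin n → ℝ) → Matrix (Fin n) (Fin n) ℝ}
  {b b' : (Fin n → ℝ) → Fin n → ℝ} {x : Fin n → ℝ} {k₁ k₂ k₃ : ℝ} {φ f : ℝ → ℝ} {I : Set ℝ}

lemma isRiemannianOn_of_form_eq_zero (ha : IsRiemannianMetricOn U a) (hφ : 0 < φ 0)
    (hb : ∀ x ∈ U, b x = 0) : IsRiemannianOn U (alphaBetaFun φ a b) := by
  refine ⟨fun x => φ 0 ^ 2 • a x, ⟨fun i j => contDiffOn_const.mul (ha.smooth i j),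
    fun x hx => (ha.posDef x hx).smul (by positivity)⟩, fun x hx y => ?_⟩
  have hbeta : beta b x y = 0 := by rw [beta, hb x hx, zero_dotProduct]
  rw [alphaBetaFun, hbeta, zero_div, alpha, alpha, Matrix.smul_mulVec, dotProduct_smul, smul_eq_mul,
    Real.sqrt_mul (by positivity), Real.sqrt_sq hφ.le, mul_comm]

lemma metricAt_add_mul_formAt_sq_pos (h : (a x).PosDef) {κ : ℝ}
    (hκ : 0 < 1 + κ * normSq a b x) {v : Fin n → ℝ} (hv : v ≠ 0) :
    0 < metricAt a x v v + κ * formAt b x v ^ 2 := by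
  have hvv := metricAt_pos h v hv
  rcases le_or_gt 0 κ with hpos | hneg
  · positivity
  · have := mul_pos hκ hvv
    have := mul_le_mul_of_nonpos_left (formAt_sq_le (b := b) h v) hneg.le
    linarith

lemma toBilin'_rankOne (M : Matrix (Fin n) (Fin n) ℝ) (ξ u v : Fin n → ℝ) (l κ : ℝ) :
    Matrix.toBilin' (l • (M + κ • Matrix.vecMulVec ξ ξ)) u v
      = l * (Matrix.toBilin' M u v + κ * (ξ ⬝ᵥ u * ξ ⬝ᵥ v)) := by
  simp only [Matrix.toBilin'_apply', Matrix.smul_mulVec, Matrix.add_mulVec,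
    Matrix.vecMulVec_mulVec, dotProduct_smul, dotProduct_add, smul_eq_mul, op_smul_eq_smul,
    dotProduct_comm u ξ]
  ring

lemma exists_isDeformedOn (hU : IsOpen U) (ha : IsRiemannianMetricOn U a) (hb : IsOneFormOn U b)
    (hf : ∀ x ∈ U, IsFactorAt k₁ k₂ k₃ f (normSq a b x))
    (hQ : ∀ x ∈ U, 0 < deformQ k₂ k₃ (normSq a b x)) :
    ∃ a' b', IsDeformedOn k₁ k₂ k₃ f U a b a' b' := by
  have hfne (x) (hx : x ∈ U) : f (normSq a b x) ≠ 0 := (hf x hx).pos.ne'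
  have ht := ha.smoothOn_normSq hb
  have hfsmooth : ContDiffOn ℝ ∞ (fun x => f (normSq a b x)) U := fun x hx =>
    ((hf x hx).contDiffAt.comp x (ht.contDiffAt (hU.mem_nhds hx))).contDiffWithinAt
  have hroot : ContDiffOn ℝ ∞ (fun x => √(deformQ k₂ k₃ (normSq a b x))) U :=
    (contDiff_deformQ.comp_contDiffOn ht).sqrt fun x hx => (hQ x hx).ne'
  set a' : (Fin n → ℝ) → Matrix (Fin n) (Fin n) ℝ := fun x => (1 / f (normSq a b x) ^ 2)
    • (a x + (k₂ - k₃ * normSq a b x) • Matrix.vecMulVec (b x) (b x))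
  have hmetric (x u v) : metricAt a' x u v = 1 / f (normSq a b x) ^ 2
      * (metricAt a x u v + (k₂ - k₃ * normSq a b x) * (formAt b x u * formAt b x v)) :=
    toBilin'_rankOne ..
  refine ⟨a', fun x => -(√(deformQ k₂ k₃ (normSq a b x)) / f (normSq a b x)) • b x,
    { isOpen := hU
      metric := ha
      form := hb
      factor := hf
      pos := hQ
      metric' := ⟨fun i j => ?_, fun x hx => posDef_of_metricAt ⟨fun u v => ?_⟩ fun v hv => ?_⟩
      form' := fun i => (hroot.div hfsmooth hfne).neg.mul (hb i)
      metric_eq := fun x hx u v => ?_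
      form_eq := fun x hx v => ?_ }⟩
  · exact (contDiffOn_const.div (hfsmooth.pow 2) fun x hx => pow_ne_zero 2 (hfne x hx)).mul
      ((ha.smooth i j).add ((contDiffOn_const.sub (contDiffOn_const.mul ht)).mul
        ((hb i).mul (hb j))))
  · rw [hmetric, hmetric, (metricAt_isSymm (ha.posDef x hx)).eq, mul_comm (formAt b x u)]
  · have hκ : 0 < 1 + (k₂ - k₃ * normSq a b x) * normSq a b x :=
      (hQ x hx).trans_eq (by rw [deformQ]; ring)
    rw [hmetric, ← sq]
    exact mul_pos (one_div_pos.2 (pow_pos (hf x hx).pos 2))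
      (metricAt_add_mul_formAt_sq_pos (ha.posDef x hx) hκ hv)
  · rw [hmetric, ← mul_assoc, mul_one_div_cancel (pow_ne_zero 2 (hfne x hx)), one_mul]
  · simp only [formAt, map_smul, LinearMap.smul_apply, smul_eq_mul]
    have := hfne x hx
    field_simp

namespace IsDeformedOn

lemma isDeformationOn (h : IsDeformedOn k₁ k₂ k₃ (eta k₁ k₂ k₃) U a b a' b')
    (hadm : ∀ x ∈ U, Admissible k₂ k₃ (normSq a b x)) : IsDeformationOn k₁ k₂ k₃ U a b a' b' := by
  intro x hx
  rw [h.normSq_eq hx]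
  refine ⟨hadm x hx, fun y => ?_⟩
  have hp' := h.metric'.posDef x hx
  have hf := (h.factor x hx).pos
  have hQ := h.pos x hx
  have hmetric := h.metric_eq x hx y y
  have hform := h.form_eq x hx y
  rw [alpha_sq hp', alpha_eq_sqrt, beta_eq_formAt, beta_eq_formAt, ← Real.sqrt_eq_rpow]
  set t := normSq a b x
  have := Real.sqrt_pos.2 hQ
  have hr2 := Real.sq_sqrt hQ.le
  have hformsq : formAt b x y ^ 2
      = eta k₁ k₂ k₃ t ^ 2 * formAt b' x y ^ 2 / deformQ k₂ k₃ t := by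
    rw [eq_div_iff hQ.ne', ← mul_pow, hform, neg_sq, mul_pow, hr2, mul_comm]
  constructor
  · have hsq : metricAt a x y y = eta k₁ k₂ k₃ t ^ 2 * (metricAt a' x y y
        - (k₂ - k₃ * t) / deformQ k₂ k₃ t * formAt b' x y ^ 2) := by
      linear_combination -hmetric - (k₂ - k₃ * t) * hformsq
    rw [hsq, Real.sqrt_mul (by positivity), Real.sqrt_sq hf.le]
  · field_simp
    linear_combination hform

lemma isDualJetAt_trace (h : IsDeformedOn k₁ k₂ k₃ f U a b a' b') (hn : 2 ≤ n)
    (hI : IsSymmetricOpenInterval I) (hφ : ContDiffOn ℝ ∞ φ I) (hφpos : ∀ s ∈ I, 0 < φ s)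
    (hφ0 : deriv φ 0 ≠ 0) (hode : SolvesODE k₁ k₂ k₃ I φ)
    (hdom : ∀ x ∈ U, ∀ y, y ≠ 0 → beta b x y / alpha a x y ∈ I)
    (hnonRiem : ∀ x ∈ U, ¬ IsRiemannianOn (connectedComponentIn U x) (alphaBetaFun φ a b))
    (hflat : IsDuallyFlatOn U (alphaBetaFun φ a b)) (hx : x ∈ U) :
    IsDualJetAt a' b' x (formAt (traceForm a') x) (traceScalar a' b' x) := by
  have hU := h.isOpen
  have hjet (x) (hx : x ∈ U) (hbx : b' x ≠ 0) :
      IsDualJetAt a' b' x (formAt (traceForm a') x) (traceScalar a' b' x) := by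
    obtain ⟨θ, m, hj⟩ := AlphaBeta.exists_isFlatJetAt hn hU h.metric h.form hI hφ hφpos hφ0 hode
      hdom hflat hx (mt (h.form_eq_zero_iff hx).2 hbx) (h.pos x hx)
    exact (h.isDualJetAt hx hj).trace (by lia) (h.metric'.posDef x hx)
  by_cases hcl : x ∈ closure {x | x ∈ U ∧ b' x ≠ 0}
  · exact .of_mem_closure hU h.metric' h.form' (fun y hy => hjet y hy.1 hy.2) hx hcl
  · have hsub := connectedComponentIn_subset U x
    have ha : IsRiemannianMetricOn (connectedComponentIn U x) a :=
      ⟨fun i j => (h.metric.smooth i j).mono hsub, fun y hy => h.metric.posDef y (hsub hy)⟩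
    refine absurd (isRiemannianOn_of_form_eq_zero ha (hφpos 0 hI.zero_mem) fun y hy => ?_)
      (hnonRiem x hx)
    exact (h.form_eq_zero_iff (hsub hy)).1
      (form_eq_zero_of_notMem_closure hn hU h.metric' h.form' hjet hx hcl hy)

end IsDeformedOn

lemma metricAt_eq_of_alpha_eq (hp : (a x).PosDef) (hp' : (a' x).PosDef) {r κ : ℝ}
    (h : ∀ y, alpha a x y = r * √(alpha a' x y ^ 2 - κ * beta b' x y ^ 2)) (u v : Fin n → ℝ) :
    metricAt a x u v = r ^ 2 * (metricAt a' x u v + -κ * (formAt b' x u * formAt b' x v)) := by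
  have hquad (y : Fin n → ℝ) :
      metricAt a x y y = r ^ 2 * (metricAt a' x y y - κ * formAt b' x y ^ 2) := by
    rcases eq_or_ne y 0 with rfl | hy
    · simp
    have hsqrt : √(metricAt a' x y y - κ * formAt b' x y ^ 2) ≠ 0 := fun h0 => by
      have := h y
      rw [alpha_eq_sqrt, alpha_sq hp', beta_eq_formAt, h0, mul_zero] at this
      exact (Real.sqrt_pos.2 (metricAt_pos hp y hy)).ne' this
    rw [← alpha_sq hp, h, mul_pow, alpha_sq hp', beta_eq_formAt,
      Real.sq_sqrt (Real.sqrt_ne_zero'.1 hsqrt).le]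
  have hsum := hquad (u + v)
  simp only [map_add, LinearMap.add_apply, (metricAt_isSymm hp).eq v u,
    (metricAt_isSymm hp').eq v u] at hsum
  linear_combination (hsum - hquad u - hquad v) / 2

lemma isDeformedOn_of_isDeformationOn (hU : IsOpen U) (ha : IsRiemannianMetricOn U a)
    (hb : IsOneFormOn U b) (ha' : IsRiemannianMetricOn U a') (hb' : IsOneFormOn U b')
    (h : IsDeformationOn k₁ k₂ k₃ U a b a' b') :
    IsDeformedOn k₁ k₂ k₃ (eta k₁ k₂ k₃) U a b a' b' := by
  have hfactor (x) (hx : x ∈ U) := isFactorAt_eta (k₁ := k₁) (h x hx).1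
  have hpos (x) (hx : x ∈ U) : 0 < deformQ k₂ k₃ (normSq a' b' x) := (h x hx).1.1
  have hmetric (x) (hx : x ∈ U) := metricAt_eq_of_alpha_eq (ha.posDef x hx) (ha'.posDef x hx)
    fun y => ((h x hx).2 y).1
  have hform (x) (hx : x ∈ U) (y) : formAt b x y = -(eta k₁ k₂ k₃ (normSq a' b' x)
      / √(deformQ k₂ k₃ (normSq a' b' x))) * formAt b' x y := by
    rw [Real.sqrt_eq_rpow]
    exact ((h x hx).2 y).2
  have hnorm (x) (hx : x ∈ U) : normSq a b x = normSq a' b' x := by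
    have hf := (hfactor x hx).pos
    have hQ := hpos x hx
    have hκ : 1 + -((k₂ - k₃ * normSq a' b' x) / deformQ k₂ k₃ (normSq a' b' x))
        * normSq a' b' x = 1 / deformQ k₂ k₃ (normSq a' b' x) := by
      field_simp
      rw [deformQ]
      ring
    rw [normSq_rankOne (ha'.posDef x hx) (ha.posDef x hx) (hmetric x hx) (hform x hx)
      (by positivity) (by rw [hκ]; positivity), hκ, neg_sq, div_pow, Real.sq_sqrt hQ.le]
    field_simp
  refine ⟨hU, ha, hb, ha', hb', fun x hx => ?_, fun x hx => ?_, fun x hx u v => ?_,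
    fun x hx v => ?_⟩ <;> rw [hnorm x hx]
  · exact hfactor x hx
  · exact hpos x hx
  · have hQ := hpos x hx
    have hr2 := Real.sq_sqrt hQ.le
    rw [hmetric x hx, hform x hx, hform x hx]
    set t := normSq a' b' x
    have := Real.sqrt_pos.2 hQ
    generalize √(deformQ k₂ k₃ t) = r at *
    rw [← hr2]
    field_simp
    ring
  · have := Real.sqrt_pos.2 (hpos x hx)
    rw [hform x hx]
    field_simp

end Deformation

end AlphaBeta

end

open AlphaBeta in
theorem theorem1p2_general {n : ℕ} (hn : 2 ≤ n) (U : Set (Fin n → ℝ)) (hU : IsOpen U)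
    (k₁ k₂ k₃ : ℝ) (I : Set ℝ) (hI : IsSymmetricOpenInterval I)
    (φ : ℝ → ℝ) (hφ : ContDiffOn ℝ ∞ φ I) (hφpos : ∀ s ∈ I, 0 < φ s)
    (hφ0 : deriv φ 0 ≠ 0) (hode : SolvesODE k₁ k₂ k₃ I φ)
    (a : (Fin n → ℝ) → Matrix (Fin n) (Fin n) ℝ) (ha : IsRiemannianMetricOn U a)
    (b : (Fin n → ℝ) → Fin n → ℝ) (hb : IsOneFormOn U b)
    (hdom : ∀ x ∈ U, ∀ y, y ≠ 0 → beta b x y / alpha a x y ∈ I)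
    (hnonRiem : ∀ x ∈ U, ¬ IsRiemannianOn (connectedComponentIn U x) (alphaBetaFun φ a b))
    (hadm : ∀ x ∈ U, Admissible k₂ k₃ (normSq a b x)) :
    IsDuallyFlatOn U (alphaBetaFun φ a b) ↔
      ∃ (a' : (Fin n → ℝ) → Matrix (Fin n) (Fin n) ℝ) (b' : (Fin n → ℝ) → Fin n → ℝ),
        IsRiemannianMetricOn U a' ∧ IsOneFormOn U b' ∧ IsDuallyFlatOn U (alpha a') ∧
        IsDuallyRelatedOn U a' b' ∧ IsDeformationOn k₁ k₂ k₃ U a b a' b' := by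
  constructor
  · intro hflat
    obtain ⟨a', b', h⟩ := exists_isDeformedOn hU ha hb
      (fun x hx => isFactorAt_eta (k₁ := k₁) (hadm x hx)) fun x hx => (hadm x hx).1
    have hjet (x) (hx : x ∈ U) :
        IsDualJetAt a' b' x (formAt (traceForm a') x) (traceScalar a' b' x) :=
      h.isDualJetAt_trace hn hI hφ hφpos hφ0 hode hdom hnonRiem hflat hx
    refine ⟨a', b', h.metric', h.form', isDuallyFlatOn_alpha hU h.metric' fun x hx =>
      (hjet x hx).metricJet_right_comm (h.metric'.posDef x hx), ?_, h.isDeformationOn hadm⟩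
    exact (isDuallyRelatedOn_iff hU h.metric' h.form').2 ⟨traceForm a', traceScalar a' b',
      isOneFormOn_traceForm hU h.metric', smoothOn_traceScalar hU h.metric' h.form', hjet⟩
  · rintro ⟨a', b', ha', hb', -, hrelated, hdeform⟩
    have h := isDeformedOn_of_isDeformationOn hU ha hb ha' hb' hdeform
    obtain ⟨θ, c, -, -, hjet⟩ := (isDuallyRelatedOn_iff hU ha' hb').1 hrelated
    exact isDuallyFlatOn_of_isFlatJetAt hU ha hb hI.isOpen hφ hode hdom fun x hx =>
      h.exists_isFlatJetAt hx (hjet x hx)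

theorem theorem1p2 {n : ℕ} (hn : 3 ≤ n) (U : Set (Fin n → ℝ)) (hU : IsOpen U)
    (k₁ k₂ k₃ : ℝ)
    (I : Set ℝ) (hI : AlphaBeta.IsSymmetricOpenInterval I)
    (φ : ℝ → ℝ) (hφ : ContDiffOn ℝ ∞ φ I) (hφpos : ∀ s ∈ I, 0 < φ s)
    (hφ0 : deriv φ 0 ≠ 0) (hode : AlphaBeta.SolvesODE k₁ k₂ k₃ I φ)
    (a : (Fin n → ℝ) → Matrix (Fin n) (Fin n) ℝ) (ha : AlphaBeta.IsRiemannianMetricOn U a)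
    (b : (Fin n → ℝ) → Fin n → ℝ) (hb : AlphaBeta.IsOneFormOn U b)
    (hdom : ∀ x ∈ U, ∀ y, y ≠ 0 → AlphaBeta.beta b x y / AlphaBeta.alpha a x y ∈ I)
    (hF : AlphaBeta.IsFinslerMetricOn U (AlphaBeta.alphaBetaFun φ a b))
    (hnonRiem : ∀ x ∈ U,
      ¬ AlphaBeta.IsRiemannianOn (connectedComponentIn U x) (AlphaBeta.alphaBetaFun φ a b))
    (hadm : ∀ x ∈ U, AlphaBeta.Admissible k₂ k₃ (AlphaBeta.normSq a b x)) :
    AlphaBeta.IsDuallyFlatOn U (AlphaBeta.alphaBetaFun φ a b) ↔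
      ∃ (a' : (Fin n → ℝ) → Matrix (Fin n) (Fin n) ℝ) (b' : (Fin n → ℝ) → Fin n → ℝ),
        AlphaBeta.IsRiemannianMetricOn U a' ∧ AlphaBeta.IsOneFormOn U b' ∧
        AlphaBeta.IsDuallyFlatOn U (AlphaBeta.alpha a') ∧
        AlphaBeta.IsDuallyRelatedOn U a' b' ∧
        AlphaBeta.IsDeformationOn k₁ k₂ k₃ U a b a' b' :=
  theorem1p2_general (by lia) U hU k₁ k₂ k₃ I hI φ hφ hφpos hφ0 hode a ha b hb hdom hnonRiem hadm
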